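/- Let $\Bbbk$ be a field and $Q$ a (nonempty) quiver, possibly infinite, that is connected as a graph. The path coalgebra $\Bbbk Q$ has the paths of $Q$ as a basis, with $\Delta(p)=\sum_{p=rq} r\otimes q$ (the sum over all ways to write $p$ as a path $q$ followed by a path $r$, trivial ones included) and $\varepsilon(p)=\delta_{|p|,0}$. Let $B\subseteq \Bbbk Q$ be an admissible subcoalgebra, i.e. one that contains all vertices and arrows of $Q$. Definitions. Let $B(x,y)$ be the set of elements of $B$ that are combinations of paths from $x$ to $y$. An element $b=\sum_{i\in I}\lambda_ip_i\in B(x,y)$ with distinct paths $p_i$ and $\lambda_i\neq 0$ is *minimal* if $|I|\ge 2$ and $\sum_{i\in I'}\lambda_ip_i\notin B(x,y)$ for all nonempty proper $I'\subset I$. Write $p\sim q$ if $p\ne q$ occur in a common minimal element. For a vertex $x_0$, $\pi_1(Q,x_0)$ is the group of homotopy classes of closed walks at $x_0$, and $N(B,x_0)$ is its normal subgroup generated by the classes of all $w^{-1}p^{-1}qw$ with $p\sim q$ paths from $x$ to $y$ and $w$ a walk from $x_0$ to $x$. A *Galois covering of quivers* $F:Q'\to Q$ is a surjective morphism of connected quivers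 that is bijective on the arrows starting, and on the arrows ending, at each vertex, such that $F_*(\pi_1(Q',x'))$ is normal in $\pi_1(Q,F(x'))$. A *lifting* of $F$ is a map $L:Q_0\to Q'_0$ with $FL=\mathrm{id}$; for a path $p$, $L(p)$ is the unique path over $p$ starting at $L(s(p))$, and $L$ is extended linearly to $\Bbbk Q$. A *Galois coalgebra covering* $F:B'\to B$ is the restriction of (the map $\Bbbk Q'\to\Bbbk Q$ induced by) a Galois covering of quivers $F:Q'\to Q$, where $B'\subseteq \Bbbk Q'$ is the span of all $L(b)$ with $L$ a lifting and $b\in B$ a minimal element or a path, and where for each minimal element $b\in B(x,y)$ and each vertex $x'$ over $x$ there are a vertex $y'$ and a minimal element $b'\in B'(x',y')$ with $F(b')=b$. A morphism from a coalgebra covering $F:B'\to B$ to $F_1:B_1\to B$ is a quiver morphism $\theta:Q'\to Q_1$ with $F_1\theta=F$ and $\theta(B')\subseteq B_1$. Fix $x_0\in Q_0$, put $G=\pi_1(Q,x_0)/N(B,x_0)$, choose a walk $c_x$ from $x_0$ to each vertex $x$, and let $\delta(a)\in G$ be the class of $c_y^{-1}ac_x$ for each arrow $a:x\to y$, extended to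 paths by $\delta(rq)=\delta(r)\delta(q)$. The quiver $Q\rtimes G$ has vertices $x\rtimes g$ and arrows $a\rtimes g$ from $s(a)\rtimes g$ to $t(a)\rtimes\delta(a)g$. Its path coalgebra is identified with the smash coproduct $\Bbbk Q\rtimes\Bbbk G$, which has basis $p\rtimes g$, $\Delta(p\rtimes g)=\sum_{p=rq}(r\rtimes\delta(q)g)\otimes(q\rtimes g)$ and $\varepsilon(p\rtimes g)=\varepsilon(p)$; here the path of $Q\rtimes G$ over $p$ that starts at $s(p)\rtimes g$ corresponds to $p\rtimes g$. Let $\tilde B=B\rtimes\Bbbk G$ be the span of all $b\rtimes g$ with $b\in B$, $g\in G$, and let $F:Q\rtimes G\to Q$, $u\rtimes g\mapsto u$. Theorem. $B$ is homogeneous for the grading of $\Bbbk Q$ by $\delta$, $\tilde B$ is an admissible subcoalgebra of $\Bbbk(Q\rtimes G)$, and: (a) $F:\tilde B\to B$ is a Galois coalgebra covering, and for every Galois coalgebra covering $F':B'\to B$ there is a Galois coalgebra covering $E:\tilde B\to B'$ with $F'E=F$. (b) For every Galois coalgebra covering $F':B'\to B$ with underlying quiver covering $F':Q'\to Q$ and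 all vertices $\tilde x$ of $Q\rtimes G$ and $x'$ of $Q'$ with $F(\tilde x)=F'(x')$, there is exactly one Galois coalgebra covering $E:\tilde B\to B'$ with $F'E=F$ and $E(\tilde x)=x'$. (c) Every Galois coalgebra covering of $B$ that has the property in (a) is isomorphic, as a coalgebra covering of $B$, to $F:\tilde B\to B$. -/

import Mathlib

open CategoryTheory Quiver
open scoped TensorProduct

universe u v w w' z

noncomputable section

namespace PathCoalg

/-! ### Paths and the path coalgebra -/

section PathCoalgebra

variable {V : Type u} [Quiver.{v} V]

/-- All (directed) paths of a quiver, bundled with their source and target. Mathlib writes paths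
from left to right: in `q.comp r` the path `q` is run first. -/
abbrev AllPaths (V : Type u) [Quiver.{v} V] := Σ x : V, Σ y : V, Path x y

/-- Bundling of a path. -/
abbrev toAll {x y : V} (p : Path x y) : AllPaths V := ⟨x, y, p⟩

/-- The list of all ways to cut `p : x → y` into `q : x → m` followed by `r : m → y`
(the trivial cuts included). -/
def splits {x : V} : {y : V} → Path x y → List (Σ m : V, Path x m × Path m y)
  | _, .nil => [⟨x, .nil, .nil⟩]
  | y, .cons p a => ⟨y, .cons p a, .nil⟩ :: (splits p).map fun d => ⟨d.1, d.2.1, d.2.2.cons a⟩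

theorem mem_splits {x y : V} (p : Path x y) (d : Σ m : V, Path x m × Path m y) :
    d ∈ splits p ↔ d.2.1.comp d.2.2 = p := by
  induction p with
  | nil =>
    obtain ⟨m, q, r⟩ := d
    constructor
    · intro h
      simp only [splits, List.mem_singleton] at h
      cases h
      rfl
    · intro h
      cases r with
      | nil => cases q with
        | nil => simp [splits]
        | cons q a => simp at h
      | cons r a => simp at h
  | cons p a ih =>
    obtain ⟨m, q, r⟩ := d
    simp only [splits, List.mem_cons, List.mem_map]
    constructor
    · rintro (h | ⟨d, hd, h⟩)
      · cases h
        rfl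
      · cases h
        simp [(ih d).1 hd]
    · intro h
      cases r with
      | nil =>
        left
        simp only [Path.comp_nil] at h
        rw [h]
      | cons r b =>
        right
        simp only [Path.comp_cons] at h
        cases h
        exact ⟨⟨m, q, r⟩, (ih _).2 rfl, rfl⟩

theorem splits_nodup {x y : V} (p : Path x y) : (splits p).Nodup := by
  induction p with
  | nil => simp [splits]
  | cons p a ih =>
    simp only [splits, List.nodup_cons, List.mem_map, not_exists, not_and]
    refine ⟨?_, ih.map ?_⟩
    · intro d _ h
      have := congrArg (fun e => e.2.2.length) h
      simp at this
    · rintro ⟨m, q, r⟩ ⟨m', q', r'⟩ h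
      simp only [Sigma.mk.injEq] at h
      obtain ⟨rfl, h⟩ := h
      simp only [heq_eq_eq, Prod.mk.injEq] at h
      obtain ⟨rfl, h⟩ := h
      cases h
      rfl

/-- Cutting a path into three pieces can be done in either order. -/
theorem splits_coassoc {M : Type*} [AddCommMonoid M] {x y : V} (p : Path x y)
    (f : ∀ m n : V, Path x m → Path m n → Path n y → M) :
    ((splits p).map fun d => ((splits d.2.2).map fun e => f d.1 e.1 d.2.1 e.2.1 e.2.2).sum).sum =
    ((splits p).map fun d => ((splits d.2.1).map fun e => f e.1 d.1 e.2.1 e.2.2 d.2.2).sum).sum := by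
  induction p with
  | nil => simp [splits]
  | cons p a ih =>
    have := ih (fun m n q s r => f m n q s (r.cons a))
    simp only [splits, List.map_cons, List.sum_cons, List.map_map, Function.comp_def,
      List.sum_map_add, List.map_nil, List.sum_nil, add_zero, this]
    abel

end PathCoalgebra

section PathCoalgebra

variable (k : Type z) [Field k] (V : Type u) [Quiver.{v} V]

/-- The path coalgebra `k Q`: the vector space on all paths. -/
def PathCoalgebra : Type (max z u v) := AllPaths V →₀ k

instance : AddCommGroup (PathCoalgebra k V) := inferInstanceAs (AddCommGroup (AllPaths V →₀ k))
instance : Module k (PathCoalgebra k V) := inferInstanceAs (Module k (AllPaths V →₀ k))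

/-- The basis of the path coalgebra that consists of the paths. -/
def pathBasis : Module.Basis (AllPaths V) k (PathCoalgebra k V) := ⟨LinearEquiv.refl k _⟩

variable {V}

/-- A path as an element of the path coalgebra. -/
def ofPath {x y : V} (p : Path x y) : PathCoalgebra k V := pathBasis k V (toAll p)

variable (V)

/-- `Δ(p) = ∑ r ⊗ q` over all cuts of `p` into `q` followed by `r`; `ε(p) = 1` if `p` has length
`0` and `ε(p) = 0` otherwise. -/
instance : CoalgebraStruct k (PathCoalgebra k V) where
  comul := (pathBasis k V).constr k fun p =>
    ((splits p.2.2).map fun d => ofPath k d.2.2 ⊗ₜ[k] ofPath k d.2.1).sum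
  counit := (pathBasis k V).constr k fun p => if p.2.2.length = 0 then 1 else 0

variable {V}

theorem comul_ofPath {x y : V} (p : Path x y) :
    Coalgebra.comul (R := k) (ofPath k p) =
      ((splits p).map fun d => ofPath k d.2.2 ⊗ₜ[k] ofPath k d.2.1).sum :=
  (pathBasis k V).constr_basis k _ _

theorem counit_ofPath {x y : V} (p : Path x y) :
    Coalgebra.counit (R := k) (ofPath k p) = if p.length = 0 then (1 : k) else 0 :=
  (pathBasis k V).constr_basis k _ _

/-- Only the trivial cut has a first piece of length zero. -/
theorem splits_sum_left {M : Type*} [AddCommMonoid M] {x y : V} (p : Path x y)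
    (f : ∀ m : V, Path m y → M) :
    ((splits p).map fun d => if d.2.1.length = 0 then f d.1 d.2.2 else 0).sum = f x p := by
  induction p with
  | nil => simp [splits]
  | cons p a ih => simpa [splits, Function.comp_def] using ih fun m r => f m (r.cons a)

/-- Only the trivial cut has a second piece of length zero. -/
theorem splits_sum_right {M : Type*} [AddCommMonoid M] {x y : V} (p : Path x y)
    (f : ∀ m : V, Path x m → M) :
    ((splits p).map fun d => if d.2.2.length = 0 then f d.1 d.2.1 else 0).sum = f y p := by
  cases p with
  | nil => simp [splits]
  | cons p a => simp [splits, Function.comp_def]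

theorem list_sum_tmul {M N ι : Type*} [AddCommGroup M] [Module k M] [AddCommGroup N] [Module k N]
    (l : List ι) (f : ι → M) (n : N) :
    (l.map f).sum ⊗ₜ[k] n = (l.map fun i => f i ⊗ₜ[k] n).sum := by
  induction l with
  | nil => simp
  | cons i l ih => simp [TensorProduct.add_tmul, ih]

theorem tmul_list_sum {M N ι : Type*} [AddCommGroup M] [Module k M] [AddCommGroup N] [Module k N]
    (l : List ι) (f : ι → M) (n : N) :
    n ⊗ₜ[k] (l.map f).sum = (l.map fun i => n ⊗ₜ[k] f i).sum := by
  induction l with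
  | nil => simp
  | cons i l ih => simp [TensorProduct.tmul_add, ih]

variable (V)

instance : Coalgebra k (PathCoalgebra k V) where
  coassoc := by
    refine (pathBasis k V).ext ?_
    rintro ⟨x, y, p⟩
    change TensorProduct.assoc k _ _ _ (LinearMap.rTensor _ _ (Coalgebra.comul (ofPath k p))) =
      LinearMap.lTensor _ _ (Coalgebra.comul (ofPath k p))
    simp only [comul_ofPath, map_list_sum, List.map_map, Function.comp_def,
      LinearMap.rTensor_tmul, LinearMap.lTensor_tmul]
    simp only [list_sum_tmul, tmul_list_sum, map_list_sum, List.map_map, Function.comp_def,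
      TensorProduct.assoc_tmul]
    exact splits_coassoc p fun m n q s r => ofPath k r ⊗ₜ[k] (ofPath k s ⊗ₜ[k] ofPath k q)
  rTensor_counit_comp_comul := by
    refine (pathBasis k V).ext ?_
    rintro ⟨x, y, p⟩
    change LinearMap.rTensor _ _ (Coalgebra.comul (ofPath k p)) = 1 ⊗ₜ[k] ofPath k p
    simp only [comul_ofPath, map_list_sum, List.map_map, Function.comp_def,
      LinearMap.rTensor_tmul, counit_ofPath, TensorProduct.ite_tmul]
    exact splits_sum_right p fun _ q => (1 : k) ⊗ₜ[k] ofPath k q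
  lTensor_counit_comp_comul := by
    refine (pathBasis k V).ext ?_
    rintro ⟨x, y, p⟩
    change LinearMap.lTensor _ _ (Coalgebra.comul (ofPath k p)) = ofPath k p ⊗ₜ[k] 1
    simp only [comul_ofPath, map_list_sum, List.map_map, Function.comp_def,
      LinearMap.lTensor_tmul, counit_ofPath, TensorProduct.tmul_ite]
    exact splits_sum_left p fun _ r => ofPath k r ⊗ₜ[k] (1 : k)

variable {V} {W : Type w} [Quiver.{w'} W]

theorem splits_mapPath (F : W ⥤q V) {x y : W} (p : Path x y) :
    splits (F.mapPath p) =
      (splits p).map fun d => ⟨F.obj d.1, F.mapPath d.2.1, F.mapPath d.2.2⟩ := by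
  induction p with
  | nil => simp [splits]
  | cons p a ih => simp [splits, ih, Function.comp_def]

theorem length_mapPath (F : W ⥤q V) {x y : W} (p : Path x y) :
    (F.mapPath p).length = p.length := by
  induction p with
  | nil => simp
  | cons p a ih => simp [ih]

/-- The action of a quiver morphism on bundled paths. -/
def mapAll (F : W ⥤q V) (P : AllPaths W) : AllPaths V := toAll (F.mapPath P.2.2)

/-- The coalgebra map `k Q' → k Q` induced by a quiver morphism `Q' → Q`. -/
def pathMap (F : W ⥤q V) : PathCoalgebra k W →ₗc[k] PathCoalgebra k V where
  toLinearMap := (pathBasis k W).constr k fun P => ofPath k (F.mapPath P.2.2)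
  counit_comp := by
    refine (pathBasis k W).ext ?_
    rintro ⟨x, y, p⟩
    rw [LinearMap.comp_apply, Module.Basis.constr_basis, counit_ofPath, length_mapPath]
    exact (counit_ofPath k p).symm
  map_comp_comul := by
    refine (pathBasis k W).ext ?_
    rintro ⟨x, y, p⟩
    rw [LinearMap.comp_apply, LinearMap.comp_apply, Module.Basis.constr_basis, comul_ofPath]
    change TensorProduct.map _ _ (Coalgebra.comul (ofPath k p)) = _
    rw [comul_ofPath]
    simp only [splits_mapPath, map_list_sum, List.map_map, Function.comp_def,
      TensorProduct.map_tmul]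
    simp only [ofPath, Module.Basis.constr_basis]

end PathCoalgebra

/-! ### Subcoalgebras, minimal elements -/

section Minimal

variable {k : Type z} [Field k] {V : Type u} [Quiver.{v} V]

/-- `B` is a subcoalgebra: `Δ(B)` lies in `B ⊗ B`. -/
def IsSubcoalgebra {C : Type*} [AddCommGroup C] [Module k C] [Coalgebra k C]
    (B : Submodule k C) : Prop :=
  ∀ b ∈ B, Coalgebra.comul (R := k) b ∈ LinearMap.range (TensorProduct.map B.subtype B.subtype)

/-- `B` is an admissible subcoalgebra of the path coalgebra: it contains all vertices and all
arrows. -/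
structure IsAdmissible (B : Submodule k (PathCoalgebra k V)) : Prop where
  isSubcoalgebra : IsSubcoalgebra B
  vertex_mem : ∀ x : V, ofPath k (Path.nil : Path x x) ∈ B
  arrow_mem : ∀ {x y : V} (a : x ⟶ y), ofPath k a.toPath ∈ B

/-- The paths that occur in `b`. -/
def supp (b : PathCoalgebra k V) : Finset (AllPaths V) := ((pathBasis k V).repr b).support

open Classical in
/-- The partial sum of `b = ∑ λ_p p` over the paths `p` in `S`. -/
def partialSum (S : Set (AllPaths V)) (b : PathCoalgebra k V) : PathCoalgebra k V :=
  ∑ p ∈ supp b with p ∈ S, (pathBasis k V).repr b p • pathBasis k V p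

/-- `B(x, y)`: the elements of `B` that are combinations of paths from `x` to `y`. -/
def homPart (B : Submodule k (PathCoalgebra k V)) (x y : V) : Submodule k (PathCoalgebra k V) :=
  B ⊓ Submodule.span k (Set.range fun p : Path x y => ofPath k p)

/-- `b` is a minimal element of `B`, lying in `B(x, y)`. -/
structure IsMinimal (B : Submodule k (PathCoalgebra k V)) (x y : V) (b : PathCoalgebra k V) :
    Prop where
  mem : b ∈ homPart B x y
  two_le : 2 ≤ (supp b).card
  partialSum_notMem : ∀ S : Finset (AllPaths V), S.Nonempty → S ⊂ supp b →
    partialSum (S : Set (AllPaths V)) b ∉ homPart B x y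

/-- The relation `p ∼ q`: the distinct paths `p` and `q` occur in a common minimal element. -/
def PathRel (B : Submodule k (PathCoalgebra k V)) {x y : V} (p q : Path x y) : Prop :=
  p ≠ q ∧ ∃ b, IsMinimal B x y b ∧ toAll p ∈ supp b ∧ toAll q ∈ supp b

end Minimal

/-! ### The fundamental group and `N(B, x₀)` -/

section FundamentalGroup

variable {k : Type z} [Field k] {V : Type u} [Quiver.{v} V]

/-- Homotopy classes of walks from `x` to `y`: the morphisms of the free groupoid on the quiver
(walks modulo cancellation of `a a⁻¹` and `a⁻¹ a`). They compose from left to right. -/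
abbrev WalkClass (x y : V) := (FreeGroupoid.of V).obj x ⟶ (FreeGroupoid.of V).obj y

/-- The fundamental group `π₁(Q, x)`; as in any `CategoryTheory.End`, in the product `g * h`
the walk `h` is run first. -/
abbrev Pi1 (V : Type u) [Quiver.{v} V] (x : V) := End ((FreeGroupoid.of V).obj x)

/-- The homotopy class of a path. -/
def pathClass {x y : V} (p : Path x y) : WalkClass x y :=
  composePath ((FreeGroupoid.of V).mapPath p)

/-- `N(B, x₀)`: the normal subgroup of `π₁(Q, x₀)` generated by the classes of the closed walks
"`w`, then `q`, then `p` backwards, then `w` backwards", where `p ∼ q` are paths from `x` to `y`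
and `w` is a walk from `x₀` to `x`. -/
def relSubgroup (B : Submodule k (PathCoalgebra k V)) (x₀ : V) : Subgroup (Pi1 V x₀) :=
  Subgroup.normalClosure {g | ∃ (x y : V) (p q : Path x y) (w : WalkClass x₀ x), PathRel B p q ∧
    g = End.of (w ≫ pathClass q ≫ Groupoid.inv (pathClass p) ≫ Groupoid.inv w)}

instance (B : Submodule k (PathCoalgebra k V)) (x₀ : V) : (relSubgroup B x₀).Normal :=
  Subgroup.normalClosure_normal

end FundamentalGroup

/-! ### Galois coverings -/

section Coverings

variable {k : Type z} [Field k] {V : Type u} [Quiver.{v} V] {W : Type w} [Quiver.{w'} W]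

/-- The quiver is nonempty and any two vertices are joined by a walk. -/
def IsConnectedQuiver (V : Type u) [Quiver.{v} V] : Prop :=
  Nonempty V ∧ ∀ x y : V, Nonempty (@Path (Symmetrify V) _ x y)

/-- A Galois covering of quivers: a surjective morphism of connected quivers that is bijective on
the arrows starting, and on the arrows ending, at each vertex, and for which `F_*(π₁(Q', x'))` is
normal in `π₁(Q, F x')`. (Surjectivity on arrows follows from surjectivity on vertices.) -/
structure IsGaloisCovering (F : W ⥤q V) : Prop where
  connected_source : IsConnectedQuiver W
  connected_target : IsConnectedQuiver V
  surjective : Function.Surjective F.obj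
  isCovering : F.IsCovering
  normal : ∀ x' : W,
    ((freeGroupoidFunctor F).mapEnd ((FreeGroupoid.of W).obj x')).range.Normal

theorem existsUnique_lift {F : W ⥤q V} (hF : F.IsCovering) {L : V → W}
    (hL : ∀ x, F.obj (L x) = x) (p : AllPaths V) :
    ∃! P : AllPaths W, P.1 = L p.1 ∧ mapAll F P = p := by
  obtain ⟨x, s⟩ := p
  obtain ⟨x', rfl⟩ : ∃ x', F.obj x' = x := ⟨_, hL x⟩
  have key : ∀ y' : W, F.obj y' = F.obj x' →
      ∃! P : AllPaths W, P.1 = y' ∧ mapAll F P = ⟨F.obj x', s⟩ := by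
    intro y' hy
    generalize F.obj x' = x at s hy
    subst hy
    obtain ⟨P, hP, hu⟩ := (hF.pathStar_bijective y').existsUnique s
    refine ⟨⟨y', P⟩, ⟨rfl, ?_⟩, ?_⟩
    · rw [← hP]
      rfl
    · rintro ⟨z, R⟩ ⟨rfl, hR⟩
      rw [hu R (eq_of_heq (Sigma.mk.inj hR).2)]
  exact key _ (hL _)

/-- The lifting `L(p)` of a path `p` along a covering: the unique path over `p` that starts at
`L(s(p))`. -/
def liftPath {F : W ⥤q V} (hF : F.IsCovering) {L : V → W} (hL : ∀ x, F.obj (L x) = x)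
    (p : AllPaths V) : AllPaths W :=
  (existsUnique_lift hF hL p).choose

/-- `L(∑ λ_p p) = ∑ λ_p L(p)`. -/
def liftElem {F : W ⥤q V} (hF : F.IsCovering) {L : V → W} (hL : ∀ x, F.obj (L x) = x) :
    PathCoalgebra k V →ₗ[k] PathCoalgebra k W :=
  (pathBasis k V).constr k fun p => pathBasis k W (liftPath hF hL p)

/-- The span of all `L(b)`, where `L` is a lifting and `b` is a minimal element of `B` or a path
that belongs to `B`. -/
def liftSpan {F : W ⥤q V} (hF : F.IsCovering) (B : Submodule k (PathCoalgebra k V)) :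
    Submodule k (PathCoalgebra k W) :=
  Submodule.span k {c | ∃ (L : V → W) (hL : ∀ x, F.obj (L x) = x) (b : PathCoalgebra k V),
    ((∃ x y, IsMinimal B x y b) ∨ (b ∈ B ∧ ∃ (x y : V) (p : Path x y), b = ofPath k p)) ∧
    c = liftElem hF hL b}

/-- The quiver morphism `F : Q' → Q` restricts to a Galois coalgebra covering `B' → B`: `F` is a
Galois covering of quivers, `B'` is the span of the liftings of the minimal elements and of the
paths of `B`, and each minimal element of `B` in `B(x, y)` lifts to a minimal element of `B'` from
any given vertex over `x`. -/
structure IsGaloisCoalgebraCovering (F : W ⥤q V) (B' : Submodule k (PathCoalgebra k W))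
    (B : Submodule k (PathCoalgebra k V)) : Prop extends IsGaloisCovering F where
  eq_liftSpan : B' = liftSpan isCovering B
  lift_minimal : ∀ (x y : V) (b : PathCoalgebra k V), IsMinimal B x y b →
    ∀ x' : W, F.obj x' = x → ∃ (y' : W) (b' : PathCoalgebra k W),
      IsMinimal B' x' y' b' ∧ pathMap k F b' = b

/-- `F : B' → B` is a Galois coalgebra covering through which each Galois coalgebra covering of
`B` (by a quiver with vertices in `Type s` and arrows in `Type t`) is factored by a Galois
coalgebra covering `E`. -/
def IsUniversalCovering.{s, t, u₁, v₁, u₂, v₂, u₃} {k : Type u₁} [Field k]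
    {V : Type u₂} [Quiver.{v₂} V] {W : Type u₃} [Quiver.{v₁} W]
    (F : W ⥤q V) (B' : Submodule k (PathCoalgebra k W))
    (B : Submodule k (PathCoalgebra k V)) : Prop :=
  IsGaloisCoalgebraCovering F B' B ∧
  ∀ (U : Type s) [Quiver.{t} U] (F₁ : U ⥤q V) (B₁ : Submodule k (PathCoalgebra k U)),
    IsGaloisCoalgebraCovering F₁ B₁ B →
      ∃ E : W ⥤q U, IsGaloisCoalgebraCovering E B' B₁ ∧ E ⋙q F₁ = F

/-- `θ` is a morphism from the coalgebra covering `F : B' → B` to `F₁ : B₁ → B`: a quiver morphism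
over `Q` whose induced coalgebra map takes `B'` into `B₁`. -/
structure IsCoveringMorphism {U : Type*} [Quiver U] (F : W ⥤q V)
    (B' : Submodule k (PathCoalgebra k W)) (F₁ : U ⥤q V) (B₁ : Submodule k (PathCoalgebra k U))
    (θ : W ⥤q U) : Prop where
  comp_eq : θ ⋙q F₁ = F
  map_mem : ∀ b ∈ B', pathMap k θ b ∈ B₁

/-- Isomorphism of coalgebra coverings of `B`: mutually inverse morphisms of coverings. -/
def CoveringsIsomorphic {U : Type*} [Quiver U] (F : W ⥤q V)
    (B' : Submodule k (PathCoalgebra k W)) (F₁ : U ⥤q V)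
    (B₁ : Submodule k (PathCoalgebra k U)) : Prop :=
  ∃ (θ : W ⥤q U) (η : U ⥤q W), IsCoveringMorphism F B' F₁ B₁ θ ∧ IsCoveringMorphism F₁ B₁ F B' η ∧
    θ ⋙q η = 𝟭q W ∧ η ⋙q θ = 𝟭q U

end Coverings

/-! ### Gradings and smash coproducts -/

section Smash

variable {V : Type u} [Quiver.{v} V] {G : Type w} [Group G]

/-- An arrow weighting with values in `G`. -/
abbrev ArrowWeighting (V : Type u) [Quiver.{v} V] (G : Type w) := ∀ ⦃x y : V⦄, (x ⟶ y) → G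

/-- The extension of an arrow weighting to paths: `δ(aₙ ⋯ a₁) = δ(aₙ) ⋯ δ(a₁)`, where `a₁` is the
first arrow of the path. -/
def pathWeight (δ : ArrowWeighting V G) {x : V} : {y : V} → Path x y → G
  | _, .nil => 1
  | _, .cons p a => δ a * pathWeight δ p

theorem pathWeight_comp (δ : ArrowWeighting V G) {x y : V} (p : Path x y) {t : V}
    (q : Path y t) : pathWeight δ (p.comp q) = pathWeight δ q * pathWeight δ p := by
  induction q with
  | nil => simp [pathWeight]
  | cons q a ih => simp [pathWeight, ih, mul_assoc]

/-- `B` is homogeneous for the grading of `k Q` in which the path `p` has degree `δ(p)`. -/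
def IsHomogeneousSub {k : Type z} [Field k] (δ : ArrowWeighting V G)
    (B : Submodule k (PathCoalgebra k V)) : Prop :=
  ∀ b ∈ B, ∀ g : G, partialSum {p : AllPaths V | pathWeight δ p.2.2 = g} b ∈ B

/-- The vertices `x ⋊ g` of the smash coproduct quiver `Q ⋊ G`. -/
@[ext] structure SmashQuiver (δ : ArrowWeighting V G) where
  /-- the vertex of the base -/
  vertex : V
  /-- the group component -/
  deg : G

/-- The arrows of `Q ⋊ G`: the arrow `a ⋊ g` goes from `s(a) ⋊ g` to `t(a) ⋊ δ(a) g`. -/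
instance (δ : ArrowWeighting V G) : Quiver.{v} (SmashQuiver δ) where
  Hom X Y := {a : X.vertex ⟶ Y.vertex // Y.deg = δ a * X.deg}

/-- The canonical map `Q ⋊ G → Q`. -/
def smashProj (δ : ArrowWeighting V G) : SmashQuiver δ ⥤q V where
  obj X := X.vertex
  map a := a.1

variable (k : Type z) [Field k]

/-- The smash coproduct coalgebra `k Q ⋊ k G`, with basis the elements `p ⋊ g`. -/
def SmashCoproduct (_δ : ArrowWeighting V G) : Type (max z u v w) := (AllPaths V × G) →₀ k

variable (δ : ArrowWeighting V G)

instance : AddCommGroup (SmashCoproduct k δ) :=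
  inferInstanceAs (AddCommGroup ((AllPaths V × G) →₀ k))
instance : Module k (SmashCoproduct k δ) :=
  inferInstanceAs (Module k ((AllPaths V × G) →₀ k))

/-- The basis of the elements `p ⋊ g`. -/
def smashBasis : Module.Basis (AllPaths V × G) k (SmashCoproduct k δ) := ⟨LinearEquiv.refl k _⟩

/-- The element `p ⋊ g`. -/
def smashPath {x y : V} (p : Path x y) (g : G) : SmashCoproduct k δ :=
  smashBasis k δ (toAll p, g)

/-- `Δ(p ⋊ g) = ∑ (r ⋊ δ(q) g) ⊗ (q ⋊ g)` over all cuts of `p` into `q` followed by `r`, and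
`ε(p ⋊ g) = ε(p)`. -/
instance : CoalgebraStruct k (SmashCoproduct k δ) where
  comul := (smashBasis k δ).constr k fun P =>
    ((splits P.1.2.2).map fun d =>
      smashPath k δ d.2.2 (pathWeight δ d.2.1 * P.2) ⊗ₜ[k] smashPath k δ d.2.1 P.2).sum
  counit := (smashBasis k δ).constr k fun P => if P.1.2.2.length = 0 then 1 else 0

theorem comul_smashPath {x y : V} (p : Path x y) (g : G) :
    Coalgebra.comul (R := k) (smashPath k δ p g) =
      ((splits p).map fun d =>
        smashPath k δ d.2.2 (pathWeight δ d.2.1 * g) ⊗ₜ[k] smashPath k δ d.2.1 g).sum :=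
  (smashBasis k δ).constr_basis k _ _

theorem counit_smashPath {x y : V} (p : Path x y) (g : G) :
    Coalgebra.counit (R := k) (smashPath k δ p g) = if p.length = 0 then (1 : k) else 0 :=
  (smashBasis k δ).constr_basis k _ _

instance : Coalgebra k (SmashCoproduct k δ) where
  coassoc := by
    refine (smashBasis k δ).ext ?_
    rintro ⟨⟨x, y, p⟩, g⟩
    change TensorProduct.assoc k _ _ _ (LinearMap.rTensor _ _ (Coalgebra.comul
      (smashPath k δ p g))) = LinearMap.lTensor _ _ (Coalgebra.comul (smashPath k δ p g))
    simp only [comul_smashPath, map_list_sum, List.map_map, Function.comp_def,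
      LinearMap.rTensor_tmul, LinearMap.lTensor_tmul]
    simp only [list_sum_tmul, tmul_list_sum, map_list_sum, List.map_map, Function.comp_def,
      TensorProduct.assoc_tmul]
    refine (splits_coassoc p fun m n q s r =>
      smashPath k δ r (pathWeight δ s * (pathWeight δ q * g)) ⊗ₜ[k]
        (smashPath k δ s (pathWeight δ q * g) ⊗ₜ[k] smashPath k δ q g)).trans ?_
    refine congrArg List.sum (List.map_congr_left fun d _ => ?_)
    refine congrArg List.sum (List.map_congr_left fun e he => ?_)
    rw [← (mem_splits _ _).1 he, pathWeight_comp, mul_assoc]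
  rTensor_counit_comp_comul := by
    refine (smashBasis k δ).ext ?_
    rintro ⟨⟨x, y, p⟩, g⟩
    change LinearMap.rTensor _ _ (Coalgebra.comul (smashPath k δ p g)) = 1 ⊗ₜ[k] smashPath k δ p g
    simp only [comul_smashPath, map_list_sum, List.map_map, Function.comp_def,
      LinearMap.rTensor_tmul, counit_smashPath, TensorProduct.ite_tmul]
    exact splits_sum_right p fun _ q => (1 : k) ⊗ₜ[k] smashPath k δ q g
  lTensor_counit_comp_comul := by
    refine (smashBasis k δ).ext ?_
    rintro ⟨⟨x, y, p⟩, g⟩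
    change LinearMap.lTensor _ _ (Coalgebra.comul (smashPath k δ p g)) = smashPath k δ p g ⊗ₜ[k] 1
    simp only [comul_smashPath, map_list_sum, List.map_map, Function.comp_def,
      LinearMap.lTensor_tmul, counit_smashPath, TensorProduct.tmul_ite]
    refine Eq.trans ?_ ((splits_sum_left p fun _ r => smashPath k δ r g ⊗ₜ[k] (1 : k)))
    refine congrArg List.sum (List.map_congr_left fun d _ => ?_)
    obtain ⟨m, q, r⟩ := d
    cases q <;> simp [pathWeight]

theorem smashQuiver_deg {X Y : SmashQuiver δ} (P : Path X Y) :
    pathWeight δ ((smashProj δ).mapPath P) * X.deg = Y.deg := by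
  induction P with
  | nil => simp [pathWeight]
  | cons P a ih =>
    refine Eq.trans ?_ (a.2.trans (congrArg _ ih.symm)).symm
    rw [← mul_assoc]
    rfl

theorem smashProj_star_bijective (X : SmashQuiver δ) :
    Function.Bijective ((smashProj δ).star X) := by
  constructor
  · rintro ⟨⟨y, h⟩, a, ha⟩ ⟨⟨y', h'⟩, a', ha'⟩ e
    obtain ⟨e1, e2⟩ := Sigma.mk.inj e
    change y = y' at e1
    subst e1
    obtain rfl : a = a' := eq_of_heq e2
    have hh : h = h' := ha.trans ha'.symm
    subst hh
    rfl
  · rintro ⟨y, a⟩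
    exact ⟨⟨⟨y, δ a * X.deg⟩, ⟨a, rfl⟩⟩, rfl⟩

theorem smash_index_bijective : Function.Bijective
    fun P : AllPaths (SmashQuiver δ) => (mapAll (smashProj δ) P, P.1.deg) := by
  constructor
  · rintro ⟨⟨x, g⟩, P⟩ ⟨⟨x', g'⟩, P'⟩ e
    simp only [mapAll, Prod.mk.injEq, Sigma.mk.injEq] at e
    obtain ⟨⟨h1, h2⟩, rfl⟩ := e
    obtain rfl : x = x' := h1
    have := ((smashProj δ).pathStar_bijective (smashProj_star_bijective δ) ⟨x, g⟩).1
      (a₁ := P) (a₂ := P') (eq_of_heq h2)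
    rw [this]
  · rintro ⟨⟨x, s⟩, g⟩
    obtain ⟨P, hP⟩ :=
      ((smashProj δ).pathStar_bijective (smashProj_star_bijective δ) ⟨x, g⟩).2 s
    refine ⟨⟨⟨x, g⟩, P⟩, ?_⟩
    rw [← hP]
    rfl

/-- The coalgebra map `k(Q ⋊ G) → k Q ⋊ k G` that sends a path `P` of `Q ⋊ G` starting at `x ⋊ g`
to `F(P) ⋊ g`, where `F : Q ⋊ G → Q` is the canonical map. -/
def smashHom : PathCoalgebra k (SmashQuiver δ) →ₗc[k] SmashCoproduct k δ where
  toLinearMap := (pathBasis k (SmashQuiver δ)).constr k fun P =>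
    smashPath k δ ((smashProj δ).mapPath P.2.2) P.1.deg
  counit_comp := by
    refine (pathBasis k _).ext ?_
    rintro ⟨X, Y, P⟩
    rw [LinearMap.comp_apply, Module.Basis.constr_basis, counit_smashPath, length_mapPath]
    exact (counit_ofPath k P).symm
  map_comp_comul := by
    refine (pathBasis k _).ext ?_
    rintro ⟨X, Y, P⟩
    rw [LinearMap.comp_apply, LinearMap.comp_apply, Module.Basis.constr_basis, comul_smashPath]
    change TensorProduct.map _ _ (Coalgebra.comul (ofPath k P)) = _
    rw [comul_ofPath]
    simp only [splits_mapPath, map_list_sum, List.map_map, Function.comp_def,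
      TensorProduct.map_tmul]
    simp only [ofPath, Module.Basis.constr_basis, smashQuiver_deg]

theorem smashHom_bijective : Function.Bijective (smashHom k δ) := by
  have h : (smashHom k δ : PathCoalgebra k (SmashQuiver δ) →ₗ[k] SmashCoproduct k δ) =
      ((pathBasis k (SmashQuiver δ)).equiv (smashBasis k δ)
        (Equiv.ofBijective _ (smash_index_bijective δ))).toLinearMap := by
    refine (pathBasis k _).ext fun P => ?_
    rw [LinearEquiv.coe_coe, Module.Basis.equiv_apply]
    exact (pathBasis k _).constr_basis k _ _
  have h' : ⇑(smashHom k δ) = ⇑((pathBasis k (SmashQuiver δ)).equiv (smashBasis k δ)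
        (Equiv.ofBijective _ (smash_index_bijective δ))) :=
    funext fun c => LinearMap.congr_fun h c
  rw [h']
  exact LinearEquiv.bijective _

/-- The identification `k(Q ⋊ G) ≅ k Q ⋊ k G` of coalgebras. -/
def smashIso : PathCoalgebra k (SmashQuiver δ) ≃ₗc[k] SmashCoproduct k δ :=
  CoalgEquiv.ofBijective (f := smashHom k δ) (smashHom_bijective k δ)

variable {k}

/-- The element `b ⋊ g` for `b` in the path coalgebra. -/
def smashElem (g : G) : PathCoalgebra k V →ₗ[k] SmashCoproduct k δ :=
  (pathBasis k V).constr k fun p => smashPath k δ p.2.2 g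

/-- `B ⋊ k G` inside `k Q ⋊ k G`: the span of all `b ⋊ g` with `b` in `B`. -/
def smashSub (B : Submodule k (PathCoalgebra k V)) : Submodule k (SmashCoproduct k δ) :=
  ⨆ g : G, B.map (smashElem δ g)

/-- `B ⋊ k G` as a subspace of the path coalgebra of `Q ⋊ G`. -/
def smashCover (B : Submodule k (PathCoalgebra k V)) :
    Submodule k (PathCoalgebra k (SmashQuiver δ)) :=
  (smashSub δ B).comap (smashIso k δ).toLinearEquiv.toLinearMap

end Smash

section Universal

variable {k : Type z} [Field k] {V : Type u} [Quiver.{v} V]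

/-- The weighting `Q₁ → π₁(Q, x₀) → π₁(Q, x₀) / N(B, x₀)` that belongs to a choice of a walk class
`c x` from `x₀` to each vertex `x` (equivalently, to a lifting of the vertices of `Q` to the
universal covering quiver): the arrow `a : x → y` gets the class of
"`c x`, then `a`, then `c y` backwards". -/
def universalWeighting (B : Submodule k (PathCoalgebra k V)) (x₀ : V)
    (c : ∀ x : V, WalkClass x₀ x) : ArrowWeighting V (Pi1 V x₀ ⧸ relSubgroup B x₀) :=
  fun x y a => QuotientGroup.mk
    (End.of (c x ≫ (FreeGroupoid.of V).map a ≫ Groupoid.inv (c y)))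

/-- The quiver `Q ⋊ (π₁(Q, x₀) / N(B, x₀))`. -/
abbrev UniversalQuiver (B : Submodule k (PathCoalgebra k V)) (x₀ : V)
    (c : ∀ x : V, WalkClass x₀ x) : Type (max u v) :=
  SmashQuiver (universalWeighting B x₀ c)

/-- The canonical map `Q ⋊ (π₁(Q, x₀) / N(B, x₀)) → Q`. -/
abbrev universalProj (B : Submodule k (PathCoalgebra k V)) (x₀ : V)
    (c : ∀ x : V, WalkClass x₀ x) : UniversalQuiver B x₀ c ⥤q V :=
  smashProj (universalWeighting B x₀ c)

/-- The smash coproduct `B ⋊ (π₁(Q, x₀) / N(B, x₀))`, inside the path coalgebra of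
`Q ⋊ (π₁(Q, x₀) / N(B, x₀))`. -/
abbrev universalCover (B : Submodule k (PathCoalgebra k V)) (x₀ : V)
    (c : ∀ x : V, WalkClass x₀ x) : Submodule k (PathCoalgebra k (UniversalQuiver B x₀ c)) :=
  smashCover (universalWeighting B x₀ c) B

end Universal

end PathCoalg

end

open PathCoalg

/-! Two observations carry the proof. The linear one: a covering is injective on the paths with a
fixed source, so an element `c` whose paths all start at one vertex behaves exactly like its image.
Slicing `Δ` with the functionals dual to vertices shows that a subcoalgebra is the sum of its parts
`B(x, y)`, and these are spanned by minimal elements and paths (`homPart_le_span_minimalOrPath`).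
Hence `c` belongs to the span of the liftings of `B` if and only if its image belongs to `B`
(`StartsAt.mem_liftSpan_iff`). This gives a cancellation rule: if `E ⋙ F₁` and `F₁` are Galois
coalgebra coverings and `E` is a Galois covering of quivers, then `E` is a Galois coalgebra covering
(`IsGaloisCoalgebraCovering.of_comp`).

The topological one: `N(B, x₀)` is made so that both sides fit. Paths with `p ∼ q` have the same
weight modulo `N`, so minimal elements are homogeneous; therefore `B` is graded, `B ⋊ G` is a
subcoalgebra, and minimal elements lift to it. A closed walk of `Q` lifts to a closed walk of `Q ⋊
G` if and only if its weight is `1`, which gives normality. Conversely, in any Galois coalgebra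
covering a minimal element lifts with a single end vertex, so `p ∼ q` have lifts with the same end
and `N` acts trivially on the fibres (`transport_eq_of_mem_relSubgroup`).

By the lifting criterion `exists_lift_of_transport_eq`, the projection `Q ⋊ G → Q` then lifts to
every Galois coalgebra covering, through any prescribed pair of vertices over the same vertex. The
cancellation rule makes the lift a Galois coalgebra covering, and uniqueness of lifts on connected
quivers gives (b) and (c). -/

noncomputable section

namespace PathCoalg

/-! ### Decomposing a subcoalgebra into the parts `B(x, y)` and minimal elements. -/

section Linear

variable {k : Type z} [Field k] {V : Type u} [Quiver.{v} V] {W : Type w} [Quiver.{w'} W]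

/-! ### Coefficients, supports and partial sums -/

theorem mem_supp {b : PathCoalgebra k V} {P : AllPaths V} :
    P ∈ supp b ↔ (pathBasis k V).repr b P ≠ 0 :=
  Finsupp.mem_support_iff

theorem supp_eq_empty {b : PathCoalgebra k V} : supp b = ∅ ↔ b = 0 := Finsupp.support_eq_empty

theorem supp_ofPath {x y : V} (p : Path x y) : supp (ofPath k p) = {toAll p} := by
  ext P
  classical
  rw [mem_supp, ofPath, Module.Basis.repr_self, Finsupp.single_apply]
  simp [eq_comm]

open Classical in
theorem repr_partialSum (S : Set (AllPaths V)) (b : PathCoalgebra k V) (P : AllPaths V) :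
    (pathBasis k V).repr (partialSum S b) P = if P ∈ S then (pathBasis k V).repr b P else 0 := by
  simp only [partialSum, map_sum, map_smul, Module.Basis.repr_self, Finsupp.coe_finsetSum,
    Finset.sum_apply, Finsupp.smul_apply, Finsupp.single_apply, smul_eq_mul, mul_ite, mul_one,
    mul_zero]
  rw [Finset.sum_ite_eq']
  by_cases hS : P ∈ S
  · by_cases hP : P ∈ supp b
    · simp [hS, hP]
    · simp [hS, hP, not_not.1 (mt mem_supp.2 hP)]
  · simp [hS]

theorem pathCoalgebra_ext {b c : PathCoalgebra k V}
    (h : ∀ P, (pathBasis k V).repr b P = (pathBasis k V).repr c P) : b = c :=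
  (pathBasis k V).repr.injective (Finsupp.ext h)

/-- The partial sum as a linear map. -/
def partialSumHom (S : Set (AllPaths V)) : PathCoalgebra k V →ₗ[k] PathCoalgebra k V where
  toFun := partialSum S
  map_add' b c := pathCoalgebra_ext fun P => by
    simp only [repr_partialSum, map_add, Finsupp.add_apply]
    split <;> simp
  map_smul' r b := pathCoalgebra_ext fun P => by
    simp [repr_partialSum]

theorem mem_supp_partialSum {S : Set (AllPaths V)} {b : PathCoalgebra k V} {P : AllPaths V} :
    P ∈ supp (partialSum S b) ↔ P ∈ supp b ∧ P ∈ S := by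
  simp [mem_supp, repr_partialSum, and_comm]

theorem card_supp_partialSum_lt {S : Set (AllPaths V)} {b : PathCoalgebra k V} {P : AllPaths V}
    (hP : P ∈ supp b) (hPS : P ∉ S) : (supp (partialSum S b)).card < (supp b).card :=
  Finset.card_lt_card (Finset.ssubset_iff_subset_ne.2
    ⟨fun _ h => (mem_supp_partialSum.1 h).1, fun h =>
      hPS (mem_supp_partialSum.1 (h.symm ▸ hP : P ∈ supp (partialSum S b))).2⟩)

theorem partialSum_add_compl (S : Set (AllPaths V)) (b : PathCoalgebra k V) :
    partialSum S b + partialSum Sᶜ b = b := by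
  refine pathCoalgebra_ext fun P => ?_
  by_cases h : P ∈ S <;> simp [repr_partialSum, h]

theorem partialSum_eq_self {S : Set (AllPaths V)} {b : PathCoalgebra k V}
    (h : ∀ P ∈ supp b, P ∈ S) : partialSum S b = b := by
  refine pathCoalgebra_ext fun P => ?_
  by_cases hP : P ∈ S
  · simp [repr_partialSum, hP]
  · simp [repr_partialSum, hP, not_not.1 (mt mem_supp.2 fun h' => hP (h P h'))]

theorem partialSum_eq_zero {S : Set (AllPaths V)} {b : PathCoalgebra k V}
    (h : ∀ P ∈ supp b, P ∉ S) : partialSum S b = 0 := by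
  refine pathCoalgebra_ext fun P => ?_
  by_cases hP : P ∈ S
  · simp [repr_partialSum, hP, not_not.1 (mt mem_supp.2 fun h' => h P h' hP)]
  · simp [repr_partialSum, hP]

theorem partialSum_ofPath (S : Set (AllPaths V)) {x y : V} (p : Path x y) [Decidable (toAll p ∈ S)] :
    partialSum S (ofPath k p) = if toAll p ∈ S then ofPath k p else 0 := by
  have key : ∀ P ∈ supp (ofPath k p), P = toAll p := fun P hP => by
    rwa [supp_ofPath, Finset.mem_singleton] at hP
  split
  · next h => exact partialSum_eq_self fun P hP => (key P hP).symm ▸ h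
  · next h => exact partialSum_eq_zero fun P hP => (key P hP).symm ▸ h

theorem mem_span_ofPath_iff {x y : V} {b : PathCoalgebra k V} :
    b ∈ Submodule.span k (Set.range fun p : Path x y => ofPath k p) ↔
      ∀ P ∈ supp b, P.1 = x ∧ P.2.1 = y := by
  have h : Submodule.span k (Set.range fun p : Path x y => ofPath k p) =
      Finsupp.supported k k (Set.range fun p : Path x y => toAll p) := by
    rw [Finsupp.supported_eq_span_single, ← Set.range_comp]
    rfl
  rw [h]
  refine Iff.trans (Finsupp.mem_supported k _) (forall₂_congr fun P _ => ?_)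
  obtain ⟨x', y', p⟩ := P
  constructor
  · rintro ⟨q, hq⟩
    cases hq
    exact ⟨rfl, rfl⟩
  · rintro ⟨rfl, rfl⟩
    exact ⟨p, rfl⟩

theorem mem_homPart_iff {B : Submodule k (PathCoalgebra k V)} {x y : V} {b : PathCoalgebra k V} :
    b ∈ homPart B x y ↔ b ∈ B ∧ ∀ P ∈ supp b, P.1 = x ∧ P.2.1 = y := by
  rw [homPart, Submodule.mem_inf, mem_span_ofPath_iff]

/-! ### Minimal elements span -/

/-- The minimal elements of `B` and the paths that belong to `B`. -/
def minimalOrPath (B : Submodule k (PathCoalgebra k V)) : Set (PathCoalgebra k V) :=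
  {b | (∃ x y, IsMinimal B x y b) ∨ (b ∈ B ∧ ∃ (x y : V) (p : Path x y), b = ofPath k p)}

theorem minimalOrPath_subset (B : Submodule k (PathCoalgebra k V)) : minimalOrPath B ⊆ B := by
  rintro b (⟨x, y, h⟩ | h)
  exacts [(mem_homPart_iff.1 h.mem).1, h.1]

/-- Induction on the number of paths that occur. An element with at least two paths that is not
minimal has a proper partial sum in `B(x, y)`; the complementary partial sum is then there too, and
both have smaller support. -/
theorem homPart_le_span_minimalOrPath (B : Submodule k (PathCoalgebra k V)) (x y : V) :
    homPart B x y ≤ Submodule.span k (minimalOrPath B) := by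
  classical
  intro b hb
  induction hn : (supp b).card using Nat.strong_induction_on generalizing b with
  | _ n ih =>
    subst hn
    rcases Nat.lt_or_ge (supp b).card 2 with h | h
    · rcases Nat.lt_or_ge (supp b).card 1 with h1 | h1
      · rw [supp_eq_empty.1 (Finset.card_eq_zero.1 (Nat.lt_one_iff.1 h1))]
        exact Submodule.zero_mem _
      · obtain ⟨P, hP⟩ := Finset.card_eq_one.1 (le_antisymm (Nat.le_of_lt_succ h) h1)
        have hne : (pathBasis k V).repr b P ≠ 0 := mem_supp.1 (hP ▸ Finset.mem_singleton_self P)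
        have hb' : b = (pathBasis k V).repr b P • ofPath k P.2.2 := by
          refine pathCoalgebra_ext fun R => ?_
          rw [map_smul, ofPath, Module.Basis.repr_self, Finsupp.smul_apply, Finsupp.single_apply]
          by_cases hR : P = R
          · subst hR
            simp
          · have : R ∉ supp b := by simpa [hP] using Ne.symm hR
            simp [hR, not_not.1 (mt mem_supp.2 this)]
        rw [hb']
        refine Submodule.smul_mem _ _ (Submodule.subset_span (Or.inr ⟨?_, _, _, P.2.2, rfl⟩))
        -- Only one path occurs, with nonzero coefficient; dividing by it puts the path itself into
        -- `B`.
        refine (B.smul_mem_iff hne).1 ?_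
        rw [← hb']
        exact (mem_homPart_iff.1 hb).1
    · by_cases hm : IsMinimal B x y b
      · exact Submodule.subset_span (Or.inl ⟨x, y, hm⟩)
      · have : ∃ S : Finset (AllPaths V), S.Nonempty ∧ S ⊂ supp b ∧
            partialSum (S : Set (AllPaths V)) b ∈ homPart B x y := by
          by_contra hcon
          push Not at hcon
          exact hm ⟨hb, h, hcon⟩
        obtain ⟨S, hS, hSb, hmem⟩ := this
        have hcompl : partialSum (S : Set (AllPaths V))ᶜ b ∈ homPart B x y := by
          rw [eq_sub_of_add_eq' (partialSum_add_compl (S : Set (AllPaths V)) b)]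
          exact Submodule.sub_mem _ hb hmem
        rw [← partialSum_add_compl (S : Set (AllPaths V)) b]
        refine Submodule.add_mem _ (ih _ ?_ hmem rfl) (ih _ ?_ hcompl rfl)
        · obtain ⟨P, hP, hPS⟩ := Finset.exists_of_ssubset hSb
          exact card_supp_partialSum_lt hP (by simpa using hPS)
        · obtain ⟨P, hP⟩ := hS
          exact card_supp_partialSum_lt (hSb.1 hP) (by simpa using hP)

/-- `B` is the sum of its parts `B(x, y)`. -/
def IsSumOfHomParts (B : Submodule k (PathCoalgebra k V)) : Prop :=
  B ≤ ⨆ (x : V) (y : V), homPart B x y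

theorem IsSumOfHomParts.span_minimalOrPath {B : Submodule k (PathCoalgebra k V)}
    (hB : IsSumOfHomParts B) : Submodule.span k (minimalOrPath B) = B :=
  le_antisymm (Submodule.span_le.2 (minimalOrPath_subset B))
    (hB.trans (iSup₂_le fun x y => homPart_le_span_minimalOrPath B x y))

/-! ### A subcoalgebra is the sum of its parts -/

/-- The functional dual to the vertex `x`. -/
def vertexCoord (x : V) : PathCoalgebra k V →ₗ[k] k :=
  (pathBasis k V).coord (toAll (Path.nil : Path x x))

open Classical in
theorem vertexCoord_ofPath (x : V) {y t : V} (p : Path y t) :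
    vertexCoord x (ofPath k p) = if p.length = 0 ∧ y = x then 1 else 0 := by
  rw [vertexCoord, ofPath, Module.Basis.coord_apply, Module.Basis.repr_self, Finsupp.single_apply]
  refine if_congr ?_ rfl rfl
  constructor
  · intro h
    cases h
    exact ⟨rfl, rfl⟩
  · rintro ⟨h, rfl⟩
    obtain rfl := Path.eq_of_length_zero p h
    rw [Path.eq_nil_of_length_zero p h]

/-- In `Δ(p) = ∑ r ⊗ q` the functional kills every `q` except the trivial path at `x`, so only the
cut at the start of `p` can survive, and it does so exactly when `p` starts at `x`. As the left side
stays in `B` when `Δ(b)` comes from `B ⊗ B`, the part of `b` with source `x` stays in `B`. -/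
theorem rid_lTensor_vertexCoord_comul (x : V) (b : PathCoalgebra k V) :
    TensorProduct.rid k _ (LinearMap.lTensor _ (vertexCoord x) (Coalgebra.comul (R := k) b)) =
      partialSum {P | P.1 = x} b := by
  classical
  refine LinearMap.congr_fun (f := ((TensorProduct.rid k _).toLinearMap ∘ₗ LinearMap.lTensor _
    (vertexCoord x)) ∘ₗ Coalgebra.comul) (g := partialSumHom {P | P.1 = x}) ?_ b
  refine (pathBasis k V).ext ?_
  rintro ⟨s, t, p⟩
  change TensorProduct.rid k _ (LinearMap.lTensor _ (vertexCoord x)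
    (Coalgebra.comul (ofPath k p))) = partialSum _ (ofPath k p)
  simp only [comul_ofPath, map_list_sum, List.map_map, Function.comp_def,
    LinearMap.lTensor_tmul, TensorProduct.rid_tmul, vertexCoord_ofPath, partialSum_ofPath,
    Set.mem_ofPred_eq, ite_smul, one_smul, zero_smul, ite_and]
  exact splits_sum_left p fun m r => if s = x then ofPath k r else 0

theorem lid_rTensor_vertexCoord_comul (y : V) (b : PathCoalgebra k V) :
    TensorProduct.lid k _ (LinearMap.rTensor _ (vertexCoord y) (Coalgebra.comul (R := k) b)) =
      partialSum {P | P.2.1 = y} b := by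
  classical
  refine LinearMap.congr_fun (f := ((TensorProduct.lid k _).toLinearMap ∘ₗ LinearMap.rTensor _
    (vertexCoord y)) ∘ₗ Coalgebra.comul) (g := partialSumHom {P | P.2.1 = y}) ?_ b
  refine (pathBasis k V).ext ?_
  rintro ⟨s, t, p⟩
  change TensorProduct.lid k _ (LinearMap.rTensor _ (vertexCoord y)
    (Coalgebra.comul (ofPath k p))) = partialSum _ (ofPath k p)
  simp only [comul_ofPath, map_list_sum, List.map_map, Function.comp_def,
    LinearMap.rTensor_tmul, TensorProduct.lid_tmul, vertexCoord_ofPath, partialSum_ofPath,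
    Set.mem_ofPred_eq, ite_smul, one_smul, zero_smul, ite_and]
  exact splits_sum_right p fun m q => if m = y then ofPath k q else 0

theorem IsSubcoalgebra.partialSum_source_mem {B : Submodule k (PathCoalgebra k V)}
    (hB : IsSubcoalgebra B) (x : V) {b : PathCoalgebra k V} (hb : b ∈ B) :
    partialSum {P | P.1 = x} b ∈ B := by
  rw [← rid_lTensor_vertexCoord_comul]
  obtain ⟨t, ht⟩ := hB b hb
  rw [← ht]
  clear ht
  induction t using TensorProduct.induction_on with
  | zero => simp
  | tmul r q =>
    simp only [TensorProduct.map_tmul, LinearMap.lTensor_tmul, TensorProduct.rid_tmul]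
    exact B.smul_mem _ r.2
  | add t t' h h' =>
    simp only [map_add]
    exact B.add_mem h h'

theorem IsSubcoalgebra.partialSum_target_mem {B : Submodule k (PathCoalgebra k V)}
    (hB : IsSubcoalgebra B) (y : V) {b : PathCoalgebra k V} (hb : b ∈ B) :
    partialSum {P | P.2.1 = y} b ∈ B := by
  rw [← lid_rTensor_vertexCoord_comul]
  obtain ⟨t, ht⟩ := hB b hb
  rw [← ht]
  clear ht
  induction t using TensorProduct.induction_on with
  | zero => simp
  | tmul r q =>
    simp only [TensorProduct.map_tmul, LinearMap.rTensor_tmul, TensorProduct.lid_tmul]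
    exact B.smul_mem _ q.2
  | add t t' h h' =>
    simp only [map_add]
    exact B.add_mem h h'

theorem sum_partialSum_fiber {ι : Type*} (f : AllPaths V → ι) (b : PathCoalgebra k V)
    (T : Finset ι) (hT : ∀ P ∈ supp b, f P ∈ T) :
    ∑ i ∈ T, partialSum {P | f P = i} b = b := by
  classical
  refine pathCoalgebra_ext fun P => ?_
  simp only [map_sum, Finsupp.coe_finsetSum, Finset.sum_apply, repr_partialSum,
    Set.mem_ofPred_eq, Finset.sum_ite_eq]
  by_cases hP : P ∈ supp b
  · simp [hT P hP]
  · simp [not_not.1 (mt mem_supp.2 hP)]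

theorem IsSubcoalgebra.isSumOfHomParts {B : Submodule k (PathCoalgebra k V)}
    (hB : IsSubcoalgebra B) : IsSumOfHomParts B := by
  classical
  intro b hb
  rw [← sum_partialSum_fiber (fun P => P.1) b ((supp b).image fun P => P.1)
    fun P hP => Finset.mem_image_of_mem _ hP]
  refine Submodule.sum_mem _ fun x _ => ?_
  set c := partialSum {P : AllPaths V | P.1 = x} b with hc
  have hcB : c ∈ B := hB.partialSum_source_mem x hb
  rw [← sum_partialSum_fiber (fun P => P.2.1) c ((supp c).image fun P => P.2.1)
    fun P hP => Finset.mem_image_of_mem _ hP]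
  refine Submodule.sum_mem _ fun y _ => ?_
  refine Submodule.mem_iSup_of_mem x (Submodule.mem_iSup_of_mem y ?_)
  refine mem_homPart_iff.2 ⟨hB.partialSum_target_mem y hcB, fun P hP => ?_⟩
  rw [mem_supp_partialSum, hc, mem_supp_partialSum] at hP
  exact ⟨hP.1.2, hP.2⟩

end Linear

end PathCoalg

end

noncomputable section

namespace PathCoalg

/-! ### Elements with one starting vertex, their liftings, and minimality along coverings. -/

section LinearCovering

variable {k : Type z} [Field k] {V : Type u} [Quiver.{v} V] {W : Type w} [Quiver.{w'} W]

/-! ### The map induced by a quiver morphism -/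

theorem pathMap_basis (F : W ⥤q V) (P : AllPaths W) :
    pathMap k F (pathBasis k W P) = pathBasis k V (mapAll F P) :=
  (pathBasis k W).constr_basis k _ _

theorem pathMap_comp {U : Type*} [Quiver U] (E : W ⥤q U) (F : U ⥤q V) (c : PathCoalgebra k W) :
    pathMap k (E ⋙q F) c = pathMap k F (pathMap k E c) := by
  refine LinearMap.congr_fun (f := (pathMap k (E ⋙q F)).toLinearMap)
    (g := (pathMap k F).toLinearMap ∘ₗ (pathMap k E).toLinearMap) ?_ c
  refine (pathBasis k W).ext fun P => ?_
  change pathMap k (E ⋙q F) _ = pathMap k F (pathMap k E _)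
  rw [pathMap_basis, pathMap_basis, pathMap_basis]
  simp only [mapAll, Prefunctor.mapPath_comp_apply]
  rfl

theorem pathMap_eq_mapDomain (F : W ⥤q V) (c : PathCoalgebra k W) :
    (pathBasis k V).repr (pathMap k F c) = ((pathBasis k W).repr c).mapDomain (mapAll F) := by
  refine LinearMap.congr_fun (f := (pathBasis k V).repr.toLinearMap ∘ₗ (pathMap k F).toLinearMap)
    (g := Finsupp.lmapDomain k k (mapAll F) ∘ₗ (pathBasis k W).repr.toLinearMap) ?_ c
  refine (pathBasis k W).ext fun P => ?_
  change (pathBasis k V).repr (pathMap k F _) = Finsupp.mapDomain _ ((pathBasis k W).repr _)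
  rw [pathMap_basis, Module.Basis.repr_self, Module.Basis.repr_self, Finsupp.mapDomain_single]

theorem exists_of_mem_supp_pathMap {F : W ⥤q V} {c : PathCoalgebra k W} {P : AllPaths V}
    (hP : P ∈ supp (pathMap k F c)) : ∃ R ∈ supp c, mapAll F R = P := by
  classical
  rw [supp, pathMap_eq_mapDomain] at hP
  exact Finset.mem_image.1 (Finsupp.mapDomain_support hP)

theorem pathMap_partialSum (F : W ⥤q V) (S : Set (AllPaths V)) (c : PathCoalgebra k W) :
    pathMap k F (partialSum (mapAll F ⁻¹' S) c) = partialSum S (pathMap k F c) := by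
  classical
  refine LinearMap.congr_fun (f := (pathMap k F).toLinearMap ∘ₗ partialSumHom (mapAll F ⁻¹' S))
    (g := partialSumHom S ∘ₗ (pathMap k F).toLinearMap) ?_ c
  refine (pathBasis k W).ext ?_
  rintro ⟨x, y, p⟩
  change pathMap k F (partialSum _ (ofPath k p)) = partialSum S (pathMap k F (ofPath k p))
  have h : pathMap k F (ofPath k p) = ofPath k (F.mapPath p) := pathMap_basis F (toAll p)
  rw [partialSum_ofPath, h, partialSum_ofPath]
  change pathMap k F (if toAll (F.mapPath p) ∈ S then _ else _) = _
  split
  · exact h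
  · exact map_zero _

theorem partialSum_congr {S T : Set (AllPaths V)} {b : PathCoalgebra k V}
    (h : ∀ P ∈ supp b, (P ∈ S ↔ P ∈ T)) : partialSum S b = partialSum T b := by
  classical
  refine pathCoalgebra_ext fun P => ?_
  by_cases hP : P ∈ supp b
  · simp [repr_partialSum, h P hP]
  · simp [repr_partialSum, not_not.1 (mt mem_supp.2 hP)]

/-- `b` is a combination of paths that start at `x`. -/
def StartsAt (x : V) (b : PathCoalgebra k V) : Prop := ∀ P ∈ supp b, P.1 = x

theorem startsAt_of_mem_homPart {B : Submodule k (PathCoalgebra k V)} {x y : V}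
    {b : PathCoalgebra k V} (h : b ∈ homPart B x y) : StartsAt x b :=
  fun P hP => ((mem_homPart_iff.1 h).2 P hP).1

theorem IsMinimal.startsAt {B : Submodule k (PathCoalgebra k V)} {x y : V}
    {b : PathCoalgebra k V} (h : IsMinimal B x y b) : StartsAt x b :=
  startsAt_of_mem_homPart h.mem

theorem startsAt_ofPath {x y : V} (p : Path x y) : StartsAt x (ofPath k p) := by
  intro P hP
  rw [supp_ofPath, Finset.mem_singleton] at hP
  rw [hP]

theorem exists_startsAt_of_mem_minimalOrPath {B : Submodule k (PathCoalgebra k V)}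
    {b : PathCoalgebra k V} (h : b ∈ minimalOrPath B) : ∃ x, StartsAt x b := by
  rcases h with ⟨x, y, h⟩ | ⟨-, x, y, p, rfl⟩
  exacts [⟨x, h.startsAt⟩, ⟨x, startsAt_ofPath p⟩]

theorem StartsAt.pathMap {x' : W} {c : PathCoalgebra k W} (h : StartsAt x' c) (F : W ⥤q V) :
    StartsAt (F.obj x') (pathMap k F c) := by
  intro P hP
  obtain ⟨R, hR, rfl⟩ := exists_of_mem_supp_pathMap hP
  exact congrArg F.obj (h R hR)

/-! ### Coverings on paths with a fixed source -/

/-- Unique path lifting. Consequently no terms cancel or merge when `F` is applied to an element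
with one starting vertex, so its support is carried over bijectively. -/
theorem mapAll_injOn {F : W ⥤q V} (hF : F.IsCovering) (x' : W) :
    Set.InjOn (mapAll F) {P | P.1 = x'} := by
  rintro ⟨s, P⟩ rfl ⟨t, R⟩ (rfl : t = s) h
  exact congrArg _ ((hF.pathStar_bijective t).1 (a₁ := P) (a₂ := R) (eq_of_heq (Sigma.mk.inj h).2))

theorem StartsAt.mapAll_injOn {F : W ⥤q V} (hF : F.IsCovering) {x' : W} {c : PathCoalgebra k W}
    (h : StartsAt x' c) : Set.InjOn (mapAll F) (supp c) :=
  (PathCoalg.mapAll_injOn hF x').mono h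

theorem StartsAt.eq_of_pathMap_eq {F : W ⥤q V} (hF : F.IsCovering) {x' : W}
    {c d : PathCoalgebra k W} (hc : StartsAt x' c) (hd : StartsAt x' d)
    (h : PathCoalg.pathMap k F c = PathCoalg.pathMap k F d) : c = d := by
  refine (pathBasis k W).repr.injective ?_
  refine Finsupp.mapDomain_injOn _ (PathCoalg.mapAll_injOn hF x') hc hd ?_
  rw [← pathMap_eq_mapDomain, ← pathMap_eq_mapDomain, h]

open Classical in
theorem StartsAt.supp_pathMap {F : W ⥤q V} (hF : F.IsCovering) {x' : W}
    {c : PathCoalgebra k W} (hc : StartsAt x' c) :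
    supp (PathCoalg.pathMap k F c) = (supp c).image (mapAll F) := by
  rw [supp, pathMap_eq_mapDomain]
  exact Finsupp.mapDomain_support_of_injOn _ (hc.mapAll_injOn hF)

theorem StartsAt.card_supp_pathMap {F : W ⥤q V} (hF : F.IsCovering) {x' : W}
    {c : PathCoalgebra k W} (hc : StartsAt x' c) :
    (supp (PathCoalg.pathMap k F c)).card = (supp c).card := by
  classical
  rw [hc.supp_pathMap hF, Finset.card_image_of_injOn (hc.mapAll_injOn hF)]

/-! ### Liftings -/

theorem liftPath_fst {F : W ⥤q V} (hF : F.IsCovering) {L : V → W} (hL : ∀ x, F.obj (L x) = x)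
    (p : AllPaths V) : (liftPath hF hL p).1 = L p.1 :=
  (existsUnique_lift hF hL p).choose_spec.1.1

theorem mapAll_liftPath {F : W ⥤q V} (hF : F.IsCovering) {L : V → W} (hL : ∀ x, F.obj (L x) = x)
    (p : AllPaths V) : mapAll F (liftPath hF hL p) = p :=
  (existsUnique_lift hF hL p).choose_spec.1.2

theorem liftElem_basis {F : W ⥤q V} (hF : F.IsCovering) {L : V → W} (hL : ∀ x, F.obj (L x) = x)
    (p : AllPaths V) :
    liftElem hF hL (pathBasis k V p) = pathBasis k W (liftPath hF hL p) :=
  (pathBasis k V).constr_basis k _ _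

theorem pathMap_liftElem {F : W ⥤q V} (hF : F.IsCovering) {L : V → W}
    (hL : ∀ x, F.obj (L x) = x) (b : PathCoalgebra k V) :
    pathMap k F (liftElem hF hL b) = b := by
  refine LinearMap.congr_fun (f := (pathMap k F).toLinearMap ∘ₗ liftElem hF hL)
    (g := LinearMap.id) ?_ b
  refine (pathBasis k V).ext fun p => ?_
  change pathMap k F (liftElem hF hL _) = _
  rw [liftElem_basis, pathMap_basis, mapAll_liftPath]
  rfl

theorem StartsAt.liftElem {F : W ⥤q V} (hF : F.IsCovering) {L : V → W}
    (hL : ∀ x, F.obj (L x) = x) {x : V} {b : PathCoalgebra k V} (hb : StartsAt x b) :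
    StartsAt (L x) (liftElem hF hL b) := by
  classical
  intro P hP
  have h : (pathBasis k W).repr (PathCoalg.liftElem hF hL b) =
      ((pathBasis k V).repr b).mapDomain (liftPath hF hL) := by
    refine LinearMap.congr_fun (f := (pathBasis k W).repr.toLinearMap ∘ₗ PathCoalg.liftElem hF hL)
      (g := Finsupp.lmapDomain k k (liftPath hF hL) ∘ₗ (pathBasis k V).repr.toLinearMap) ?_ b
    refine (pathBasis k V).ext fun P => ?_
    change (pathBasis k W).repr (PathCoalg.liftElem hF hL _) =
      Finsupp.mapDomain _ ((pathBasis k V).repr _)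
    rw [liftElem_basis, Module.Basis.repr_self, Module.Basis.repr_self, Finsupp.mapDomain_single]
  rw [supp, h] at hP
  obtain ⟨R, hR, rfl⟩ := Finset.mem_image.1 (Finsupp.mapDomain_support hP)
  rw [liftPath_fst, hb R hR]

theorem StartsAt.liftElem_pathMap {F : W ⥤q V} (hF : F.IsCovering) {L : V → W}
    (hL : ∀ x, F.obj (L x) = x) {x' : W} (hx' : L (F.obj x') = x') {c : PathCoalgebra k W}
    (hc : StartsAt x' c) : PathCoalg.liftElem hF hL (PathCoalg.pathMap k F c) = c := by
  have h := (hc.pathMap F).liftElem hF hL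
  rw [hx'] at h
  exact h.eq_of_pathMap_eq hF hc (pathMap_liftElem hF hL _)

theorem exists_lifting_through {F : W ⥤q V} (hs : Function.Surjective F.obj) (x' : W) :
    ∃ L : V → W, (∀ x, F.obj (L x) = x) ∧ L (F.obj x') = x' := by
  classical
  refine ⟨Function.update (Function.surjInv hs) (F.obj x') x', fun x => ?_, by simp⟩
  by_cases h : x = F.obj x'
  · subst h
    simp
  · simp [h, Function.surjInv_eq]

theorem pathMap_mem_of_mem_liftSpan {F : W ⥤q V} (hF : F.IsCovering)
    {B : Submodule k (PathCoalgebra k V)} {c : PathCoalgebra k W} (hc : c ∈ liftSpan hF B) :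
    pathMap k F c ∈ B := by
  have h : liftSpan hF B ≤ B.comap (pathMap k F).toLinearMap := by
    refine Submodule.span_le.2 ?_
    rintro _ ⟨L, hL, b, hb, rfl⟩
    change pathMap k F _ ∈ B
    rw [pathMap_liftElem]
    exact minimalOrPath_subset B hb
  exact h hc

theorem liftElem_mem_liftSpan {F : W ⥤q V} (hF : F.IsCovering)
    {B : Submodule k (PathCoalgebra k V)} (hB : IsSumOfHomParts B) {L : V → W}
    (hL : ∀ x, F.obj (L x) = x) {b : PathCoalgebra k V} (hb : b ∈ B) :
    liftElem hF hL b ∈ liftSpan hF B := by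
  have h : Submodule.span k (minimalOrPath B) ≤ (liftSpan hF B).comap (liftElem hF hL) :=
    Submodule.span_le.2 fun b hb => Submodule.subset_span ⟨L, hL, b, hb, rfl⟩
  exact h (hB.span_minimalOrPath.symm ▸ hb)

/-- If the lifting `L` passes through `x'`, then `c = L(F(c))`, and `L` takes all of `B` into the
span because minimal elements and paths span `B`. This turns membership in a span into a test on the
image. -/
theorem StartsAt.mem_liftSpan_iff {F : W ⥤q V} (hF : F.IsCovering)
    (hs : Function.Surjective F.obj) {B : Submodule k (PathCoalgebra k V)}
    (hB : IsSumOfHomParts B) {x' : W} {c : PathCoalgebra k W} (hc : StartsAt x' c) :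
    c ∈ liftSpan hF B ↔ PathCoalg.pathMap k F c ∈ B := by
  refine ⟨pathMap_mem_of_mem_liftSpan hF, fun h => ?_⟩
  obtain ⟨L, hL, hx'⟩ := exists_lifting_through hs x'
  rw [← hc.liftElem_pathMap hF hL hx']
  exact liftElem_mem_liftSpan hF hB hL h

/-- A description free of liftings and minimal elements, which allows spans for different coverings
to be compared. -/
theorem liftSpan_eq_span {F : W ⥤q V} (hF : F.IsCovering) (hs : Function.Surjective F.obj)
    {B : Submodule k (PathCoalgebra k V)} (hB : IsSumOfHomParts B) :
    liftSpan hF B = Submodule.span k {c | (∃ x', StartsAt x' c) ∧ pathMap k F c ∈ B} := by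
  refine le_antisymm (Submodule.span_mono ?_) (Submodule.span_le.2 ?_)
  · rintro _ ⟨L, hL, b, hb, rfl⟩
    obtain ⟨x, hx⟩ := exists_startsAt_of_mem_minimalOrPath hb
    refine ⟨⟨_, hx.liftElem hF hL⟩, ?_⟩
    rw [pathMap_liftElem]
    exact minimalOrPath_subset B hb
  · rintro c ⟨⟨x', hc⟩, h⟩
    exact (hc.mem_liftSpan_iff hF hs hB).2 h

/-! ### Minimal elements and coverings -/

theorem mem_homPart_liftSpan {F : W ⥤q V} (hF : F.IsCovering)
    (hs : Function.Surjective F.obj) {B : Submodule k (PathCoalgebra k V)}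
    (hB : IsSumOfHomParts B) {x' y' : W} {c : PathCoalgebra k W}
    (hc : ∀ P ∈ supp c, P.1 = x' ∧ P.2.1 = y') (h : pathMap k F c ∈ B) :
    c ∈ homPart (liftSpan hF B) x' y' :=
  mem_homPart_iff.2 ⟨(StartsAt.mem_liftSpan_iff hF hs hB fun P hP => (hc P hP).1).2 h, hc⟩

theorem pathMap_mem_homPart {F : W ⥤q V} {B : Submodule k (PathCoalgebra k V)}
    {B' : Submodule k (PathCoalgebra k W)} (hBB' : ∀ c ∈ B', pathMap k F c ∈ B)
    {x' y' : W} {c : PathCoalgebra k W} (hc : c ∈ homPart B' x' y') :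
    pathMap k F c ∈ homPart B (F.obj x') (F.obj y') := by
  obtain ⟨h1, h2⟩ := mem_homPart_iff.1 hc
  refine mem_homPart_iff.2 ⟨hBB' c h1, fun P hP => ?_⟩
  obtain ⟨R, hR, rfl⟩ := exists_of_mem_supp_pathMap hP
  exact ⟨congrArg F.obj (h2 R hR).1, congrArg F.obj (h2 R hR).2⟩

/-- A partial sum of `F(c)` in `B` is the image of the partial sum of `c` over the preimage of the
index set. That one inherits both ends from `c`, hence would split `c` inside the span of liftings.
-/
theorem IsMinimal.pathMap {F : W ⥤q V} (hF : F.IsCovering)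
    (hs : Function.Surjective F.obj) {B : Submodule k (PathCoalgebra k V)}
    (hB : IsSumOfHomParts B) {x' y' : W} {c : PathCoalgebra k W}
    (hc : IsMinimal (liftSpan hF B) x' y' c) :
    IsMinimal B (F.obj x') (F.obj y') (pathMap k F c) := by
  classical
  refine ⟨pathMap_mem_homPart (fun _ => pathMap_mem_of_mem_liftSpan hF) hc.mem, ?_, ?_⟩
  · rw [hc.startsAt.card_supp_pathMap hF]
    exact hc.two_le
  · intro S hS hSc hmem
    have hT : partialSum (mapAll F ⁻¹' (S : Set (AllPaths V))) c =
        partialSum (({P ∈ supp c | mapAll F P ∈ S} : Finset _) : Set (AllPaths W)) c :=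
      partialSum_congr fun P hP => by simp [hP]
    refine hc.partialSum_notMem {P ∈ supp c | mapAll F P ∈ S} ?_ ?_ ?_
    · obtain ⟨P, hP⟩ := hS
      obtain ⟨R, hR, rfl⟩ := exists_of_mem_supp_pathMap (hSc.1 hP)
      exact ⟨R, Finset.mem_filter.2 ⟨hR, hP⟩⟩
    · obtain ⟨P, hP, hPS⟩ := Finset.exists_of_ssubset hSc
      obtain ⟨R, hR, rfl⟩ := exists_of_mem_supp_pathMap hP
      exact Finset.filter_ssubset.2 ⟨R, hR, hPS⟩
    · rw [← hT]
      refine mem_homPart_liftSpan hF hs hB (fun P hP => ?_) ?_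
      · exact (mem_homPart_iff.1 hc.mem).2 P (mem_supp_partialSum.1 hP).1
      · rw [pathMap_partialSum]
        exact (mem_homPart_iff.1 hmem).1

/-- A splitting of `c` pushes down to a splitting of `F(c)`, and injectivity on the support keeps it
proper. For this direction `F(B') ⊆ B` is enough. -/
theorem IsMinimal.of_pathMap {F : W ⥤q V} (hF : F.IsCovering)
    {B : Submodule k (PathCoalgebra k V)} {B' : Submodule k (PathCoalgebra k W)}
    (hBB' : ∀ c ∈ B', PathCoalg.pathMap k F c ∈ B) {x' y' : W} {c : PathCoalgebra k W}
    (hc : c ∈ homPart B' x' y')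
    (h : IsMinimal B (F.obj x') (F.obj y') (PathCoalg.pathMap k F c)) :
    IsMinimal B' x' y' c := by
  classical
  have hst := startsAt_of_mem_homPart hc
  refine ⟨hc, ?_, ?_⟩
  · rw [← hst.card_supp_pathMap hF]
    exact h.two_le
  · intro S hS hSc hmem
    have hT : partialSum (mapAll F ⁻¹' ((S.image (mapAll F) : Finset _) : Set (AllPaths V))) c =
        partialSum (S : Set (AllPaths W)) c := by
      refine partialSum_congr fun P hP => ?_
      simp only [Finset.coe_image, Set.mem_preimage]
      exact (hst.mapAll_injOn hF).mem_image_iff (Finset.coe_subset.2 hSc.1) hP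
    refine h.partialSum_notMem (S.image (mapAll F)) (hS.image _) ?_ ?_
    · rw [hst.supp_pathMap hF, ← Finset.coe_ssubset, Finset.coe_image, Finset.coe_image,
        (hst.mapAll_injOn hF).image_ssubset_image_iff (Finset.coe_subset.2 hSc.1) subset_rfl]
      exact Finset.coe_ssubset.2 hSc
    · rw [← pathMap_partialSum, hT]
      exact pathMap_mem_homPart hBB' hmem

theorem IsGaloisCoalgebraCovering.pathMap_mem {F : W ⥤q V} {B' : Submodule k (PathCoalgebra k W)}
    {B : Submodule k (PathCoalgebra k V)} (h : IsGaloisCoalgebraCovering F B' B)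
    {c : PathCoalgebra k W} (hc : c ∈ B') : pathMap k F c ∈ B :=
  pathMap_mem_of_mem_liftSpan h.isCovering (h.eq_liftSpan ▸ hc)

/-- `B'` is not known to be a subcoalgebra, so vertex functionals are not available. Instead
`lift_minimal` is the source of the decomposition: the lifting of a minimal element coincides with
the minimal element of `B'` over it that has the same start, and so has a single end. -/
theorem IsGaloisCoalgebraCovering.isSumOfHomParts {F : W ⥤q V}
    {B' : Submodule k (PathCoalgebra k W)} {B : Submodule k (PathCoalgebra k V)}
    (h : IsGaloisCoalgebraCovering F B' B) : IsSumOfHomParts B' := by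
  have key : liftSpan h.isCovering B ≤ ⨆ (x : W) (y : W), homPart B' x y := by
    refine Submodule.span_le.2 ?_
    rintro _ ⟨L, hL, b, hb, rfl⟩
    have hmem : liftElem h.isCovering hL b ∈ B' :=
      h.eq_liftSpan.ge (Submodule.subset_span ⟨L, hL, b, hb, rfl⟩)
    rcases hb with ⟨x, y, hb⟩ | ⟨hb, x, y, p, rfl⟩
    · obtain ⟨y', b', hb', rfl⟩ := h.lift_minimal x y b hb (L x) (hL x)
      have := (hb.startsAt.liftElem h.isCovering hL).eq_of_pathMap_eq h.isCovering hb'.startsAt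
        (pathMap_liftElem _ _ _)
      rw [this]
      exact Submodule.mem_iSup_of_mem (L x) (Submodule.mem_iSup_of_mem y' hb'.mem)
    · have hl : liftElem h.isCovering hL (ofPath k p) =
          ofPath k (liftPath h.isCovering hL (toAll p)).2.2 := liftElem_basis _ _ _
      rw [hl] at hmem ⊢
      refine Submodule.mem_iSup_of_mem (liftPath h.isCovering hL (toAll p)).1
        (Submodule.mem_iSup_of_mem (liftPath h.isCovering hL (toAll p)).2.1
          (mem_homPart_iff.2 ⟨hmem, fun P hP => ?_⟩))
      rw [supp_ofPath, Finset.mem_singleton] at hP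
      rw [hP]
      exact ⟨rfl, rfl⟩
  intro b hb
  exact key (h.eq_liftSpan ▸ hb)

/-- If `E ⋙ F₁` and `F₁` are Galois coalgebra coverings and `E` is a Galois covering of quivers,
then `E` is a Galois coalgebra covering. -/
theorem IsGaloisCoalgebraCovering.of_comp {U : Type*} [Quiver U] {E : W ⥤q U} {F₁ : U ⥤q V}
    {B' : Submodule k (PathCoalgebra k W)} {B₁ : Submodule k (PathCoalgebra k U)}
    {B : Submodule k (PathCoalgebra k V)} (hB : IsSumOfHomParts B)
    (h : IsGaloisCoalgebraCovering (E ⋙q F₁) B' B) (h₁ : IsGaloisCoalgebraCovering F₁ B₁ B)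
    (hE : IsGaloisCovering E) : IsGaloisCoalgebraCovering E B' B₁ where
  toIsGaloisCovering := hE
  eq_liftSpan := by
    rw [liftSpan_eq_span hE.isCovering hE.surjective h₁.isSumOfHomParts, h.eq_liftSpan,
      liftSpan_eq_span h.isCovering h.surjective hB]
    congr 1
    ext c
    -- The generators match: `E(c)` again has one starting vertex, so `E(c) ∈ B₁` is equivalent to
    -- `F₁(E(c)) ∈ B`.
    refine and_congr_right ?_
    rintro ⟨x', hc⟩
    rw [pathMap_comp, h₁.eq_liftSpan,
      (hc.pathMap E).mem_liftSpan_iff h₁.isCovering h₁.surjective hB]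
  lift_minimal := by
    rintro x₁ y₁ b₁ hb₁ x' rfl
    have hm : IsMinimal B (F₁.obj (E.obj x')) (F₁.obj y₁) (pathMap k F₁ b₁) := by
      rw [h₁.eq_liftSpan] at hb₁
      exact hb₁.pathMap h₁.isCovering h₁.surjective hB
    -- Down to `B` along `F₁`, then up along the composite. `E(b')` and `b₁` start at the same
    -- vertex and have the same image under `F₁`, hence agree.
    obtain ⟨y', b', hb', e⟩ := h.lift_minimal _ _ _ hm x' rfl
    rw [pathMap_comp] at e
    exact ⟨y', b', hb', (hb'.startsAt.pathMap E).eq_of_pathMap_eq h₁.isCovering hb₁.startsAt e⟩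

end LinearCovering

end PathCoalg

end

noncomputable section

namespace PathCoalg

/-! ### Homotopy classes of walks, monodromy, and lifting of quiver morphisms. -/

section Monodromy

variable {V : Type u} [Quiver.{v} V] {W : Type w} [Quiver.{w'} W]

/-! ### Walk classes -/

/-- Induction on the number of steps of a walk. -/
theorem walkClass_induction {x : V} {P : ∀ y : V, WalkClass x y → Prop}
    (nil : P x (𝟙 _))
    (pos : ∀ (y t : V) (γ : WalkClass x y) (a : y ⟶ t), P y γ →
      P t (γ ≫ (FreeGroupoid.of V).map a))
    (neg : ∀ (y t : V) (γ : WalkClass x y) (a : t ⟶ y), P y γ →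
      P t (γ ≫ Groupoid.inv ((FreeGroupoid.of V).map a)))
    {y : V} (γ : WalkClass x y) : P y γ := by
  induction γ using Quot.ind with
  | _ p =>
    change @Path (Symmetrify V) _ x y at p
    induction p with
    | nil => exact nil
    | cons p e ih =>
      rcases e with a | a
      · exact pos _ _ _ a ih
      · exact neg _ _ _ a ih

theorem isConnectedQuiver_iff :
    IsConnectedQuiver V ↔ Nonempty V ∧ ∀ x y : V, Nonempty (WalkClass x y) := by
  refine and_congr_right fun _ => forall₂_congr fun x y => ⟨?_, ?_⟩
  · rintro ⟨p⟩
    exact ⟨Quot.mk _ p⟩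
  · rintro ⟨γ⟩
    obtain ⟨p, -⟩ := Quot.exists_rep γ
    exact ⟨p⟩

/-- The action of a quiver morphism on walk classes. -/
def mapWalk (F : W ⥤q V) {x y : W} (γ : WalkClass x y) : WalkClass (F.obj x) (F.obj y) :=
  (freeGroupoidFunctor F).map γ

@[simp] theorem mapWalk_id (F : W ⥤q V) (x : W) :
    mapWalk F (𝟙 ((FreeGroupoid.of W).obj x)) = 𝟙 _ :=
  (freeGroupoidFunctor F).map_id _

@[simp] theorem mapWalk_comp (F : W ⥤q V) {x y t : W} (γ : WalkClass x y) (η : WalkClass y t) :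
    mapWalk F (γ ≫ η) = mapWalk F γ ≫ mapWalk F η :=
  (freeGroupoidFunctor F).map_comp _ _

@[simp] theorem mapWalk_inv (F : W ⥤q V) {x y : W} (γ : WalkClass x y) :
    mapWalk F (Groupoid.inv γ) = Groupoid.inv (mapWalk F γ) := by
  rw [Groupoid.inv_eq_inv, Groupoid.inv_eq_inv]
  exact (freeGroupoidFunctor F).map_inv γ

@[simp] theorem mapWalk_of (F : W ⥤q V) {x y : W} (a : x ⟶ y) :
    mapWalk F ((FreeGroupoid.of W).map a) = (FreeGroupoid.of V).map (F.map a) :=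
  rfl

theorem mapWalk_comp_apply {U : Type*} [Quiver U] (E : W ⥤q U) (F : U ⥤q V) {x y : W}
    (γ : WalkClass x y) : mapWalk (E ⋙q F) γ = mapWalk F (mapWalk E γ) := by
  induction γ using walkClass_induction with
  | nil =>
    rw [mapWalk_id, mapWalk_id, mapWalk_id]
    rfl
  | pos y t γ a ih =>
    rw [mapWalk_comp, mapWalk_comp, mapWalk_comp, ih]
    rfl
  | neg y t γ a ih =>
    rw [mapWalk_comp, mapWalk_comp, mapWalk_comp, mapWalk_inv, mapWalk_inv, mapWalk_inv, ih]
    rfl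

theorem pathClass_cons {x y t : V} (p : Path x y) (a : y ⟶ t) :
    pathClass (p.cons a) = pathClass p ≫ (FreeGroupoid.of V).map a := rfl

theorem pathClass_mapPath (F : W ⥤q V) {x y : W} (p : Path x y) :
    pathClass (F.mapPath p) = mapWalk F (pathClass p) := by
  induction p with
  | nil => exact (mapWalk_id F x).symm
  | cons p a ih => rw [Prefunctor.mapPath_cons, pathClass_cons, pathClass_cons, ih, mapWalk_comp,
      mapWalk_of]

/-- A covering lifts walk classes. -/
theorem exists_lift_walk {F : W ⥤q V} (hF : F.IsCovering) (x' : W) {y : V}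
    (γ : WalkClass (F.obj x') y) :
    ∃ (y' : W) (γ' : WalkClass x' y'),
      (⟨F.obj y', mapWalk F γ'⟩ : Σ y, WalkClass (F.obj x') y) = ⟨y, γ⟩ := by
  induction γ using walkClass_induction with
  | nil => exact ⟨x', 𝟙 _, by simp⟩
  | pos y t γ a ih =>
    obtain ⟨y', γ', h⟩ := ih
    cases h
    obtain ⟨⟨t', a'⟩, h⟩ := (hF.star_bijective y').2 ⟨t, a⟩
    cases h
    exact ⟨t', γ' ≫ (FreeGroupoid.of W).map a', by simp⟩
  | neg y t γ a ih =>
    obtain ⟨y', γ', h⟩ := ih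
    cases h
    obtain ⟨⟨t', a'⟩, h⟩ := (hF.costar_bijective y').2 ⟨t, a⟩
    cases h
    exact ⟨t', γ' ≫ Groupoid.inv ((FreeGroupoid.of W).map a'), by
      rw [mapWalk_comp, mapWalk_inv, mapWalk_of]⟩

/-! ### Transport of fibres along walks -/

/-- The fibre of a quiver morphism over a vertex. -/
abbrev Fiber (F : W ⥤q V) (x : V) := {x' : W // F.obj x' = x}

/-- Some arrow from `s` to `t` lies over `a`. -/
def OverArrow (F : W ⥤q V) {x y : V} (a : x ⟶ y) (s t : W) : Prop :=
  ∃ a' : s ⟶ t, (⟨F.obj s, F.obj t, F.map a'⟩ : Σ x y : V, x ⟶ y) = ⟨x, y, a⟩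

/-- Bijectivity on stars, phrased for fibres. `OverArrow` compares arrows bundled with their ends
because the ends of `F.map a'` and of `a` agree only propositionally. -/
theorem existsUnique_overArrow_target {F : W ⥤q V} (hF : F.IsCovering) {x y : V} (a : x ⟶ y)
    (s : Fiber F x) : ∃! t : Fiber F y, OverArrow F a s.1 t.1 := by
  obtain ⟨s, rfl⟩ := s
  obtain ⟨⟨t, a'⟩, h⟩ := (hF.star_bijective s).2 ⟨y, a⟩
  cases h
  refine ⟨⟨t, rfl⟩, ⟨a', rfl⟩, ?_⟩
  rintro ⟨t₂, h₂⟩ ⟨a₂, e⟩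
  have := (hF.star_bijective s).1 (a₁ := ⟨t₂, a₂⟩) (a₂ := ⟨t, a'⟩)
    (eq_of_heq (Sigma.mk.inj e).2)
  exact Subtype.ext (congrArg Sigma.fst this)

theorem sigma_costar_eq_of_eq {x y t : V} {a : x ⟶ t} {b : y ⟶ t}
    (h : (⟨x, t, a⟩ : Σ x y : V, x ⟶ y) = ⟨y, t, b⟩) :
    (⟨x, a⟩ : Quiver.Costar t) = ⟨y, b⟩ := by
  cases h
  rfl

theorem existsUnique_overArrow_source {F : W ⥤q V} (hF : F.IsCovering) {x y : V} (a : x ⟶ y)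
    (t : Fiber F y) : ∃! s : Fiber F x, OverArrow F a s.1 t.1 := by
  obtain ⟨t, rfl⟩ := t
  obtain ⟨⟨s, a'⟩, h⟩ := (hF.costar_bijective t).2 ⟨x, a⟩
  cases h
  refine ⟨⟨s, rfl⟩, ⟨a', rfl⟩, ?_⟩
  rintro ⟨s₂, h₂⟩ ⟨a₂, e⟩
  have := (hF.costar_bijective t).1 (a₁ := ⟨s₂, a₂⟩) (a₂ := ⟨s, a'⟩)
    (sigma_costar_eq_of_eq e)
  exact Subtype.ext (congrArg Sigma.fst this)

/-- The bijection of fibres that belongs to an arrow. -/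
def arrowTransport {F : W ⥤q V} (hF : F.IsCovering) {x y : V} (a : x ⟶ y) :
    Fiber F x ≃ Fiber F y where
  toFun s := (existsUnique_overArrow_target hF a s).choose
  invFun t := (existsUnique_overArrow_source hF a t).choose
  left_inv s := ((existsUnique_overArrow_source hF a _).choose_spec.2 s
    (existsUnique_overArrow_target hF a s).choose_spec.1).symm
  right_inv t := ((existsUnique_overArrow_target hF a _).choose_spec.2 t
    (existsUnique_overArrow_source hF a t).choose_spec.1).symm

theorem overArrow_arrowTransport {F : W ⥤q V} (hF : F.IsCovering) {x y : V} (a : x ⟶ y)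
    (s : Fiber F x) : OverArrow F a s.1 (arrowTransport hF a s).1 :=
  (existsUnique_overArrow_target hF a s).choose_spec.1

theorem arrowTransport_map {F : W ⥤q V} (hF : F.IsCovering) {s t : W} (a : s ⟶ t) :
    arrowTransport hF (F.map a) ⟨s, rfl⟩ = ⟨t, rfl⟩ :=
  ((existsUnique_overArrow_target hF (F.map a) ⟨s, rfl⟩).choose_spec.2 ⟨t, rfl⟩ ⟨a, rfl⟩).symm

/-- The groupoid with objects the vertices of the base and morphisms the bijections of fibres. -/
structure FiberGroupoid (F : W ⥤q V) where
  /-- the vertex of the base -/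
  vertex : V

/-- A target for the universal property of the free groupoid: bijections assigned to arrows extend
to walk classes, so homotopy invariance of transport needs no separate argument. -/
instance (F : W ⥤q V) : Groupoid (FiberGroupoid F) where
  Hom x y := Fiber F x.vertex ≃ Fiber F y.vertex
  id _ := Equiv.refl _
  comp f g := f.trans g
  inv f := f.symm
  inv_comp f := f.symm_trans_self
  comp_inv f := f.self_trans_symm

/-- The monodromy functor of a covering. -/
def monodromy {F : W ⥤q V} (hF : F.IsCovering) : Quiver.FreeGroupoid V ⥤ FiberGroupoid F :=
  FreeGroupoid.lift
    { obj := fun x => ⟨x⟩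
      map := fun a => arrowTransport hF a }

/-- The bijection of fibres that belongs to a walk class. -/
def transport {F : W ⥤q V} (hF : F.IsCovering) {x y : V} (γ : WalkClass x y) :
    Fiber F x ≃ Fiber F y :=
  (monodromy hF).map γ

@[simp] theorem transport_id {F : W ⥤q V} (hF : F.IsCovering) (x : V) (s : Fiber F x) :
    transport hF (𝟙 ((FreeGroupoid.of V).obj x)) s = s :=
  Equiv.congr_fun ((monodromy hF).map_id _) s

@[simp] theorem transport_comp {F : W ⥤q V} (hF : F.IsCovering) {x y t : V} (γ : WalkClass x y)
    (η : WalkClass y t) (s : Fiber F x) :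
    transport hF (γ ≫ η) s = transport hF η (transport hF γ s) :=
  Equiv.congr_fun ((monodromy hF).map_comp γ η) s

@[simp] theorem transport_inv {F : W ⥤q V} (hF : F.IsCovering) {x y : V} (γ : WalkClass x y)
    (s : Fiber F y) : transport hF (Groupoid.inv γ) s = (transport hF γ).symm s := by
  rw [Equiv.eq_symm_apply, ← transport_comp, Groupoid.inv_comp, transport_id]

@[simp] theorem transport_of {F : W ⥤q V} (hF : F.IsCovering) {x y : V} (a : x ⟶ y) :
    transport hF ((FreeGroupoid.of V).map a) = arrowTransport hF a :=
  rfl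

theorem transport_mapWalk {F : W ⥤q V} (hF : F.IsCovering) {x y : W} (γ : WalkClass x y) :
    transport hF (mapWalk F γ) ⟨x, rfl⟩ = ⟨y, rfl⟩ := by
  induction γ using walkClass_induction with
  | nil => simp
  | pos y t γ a ih => simp [ih, arrowTransport_map]
  | neg y t γ a ih => 
    rw [mapWalk_comp, mapWalk_inv, transport_comp, transport_inv, ih, Equiv.symm_apply_eq]
    exact (arrowTransport_map hF a).symm

theorem transport_pathClass_mapPath {F : W ⥤q V} (hF : F.IsCovering) {x y : W} (p : Path x y) :
    transport hF (pathClass (F.mapPath p)) ⟨x, rfl⟩ = ⟨y, rfl⟩ := by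
  rw [pathClass_mapPath, transport_mapWalk]

/-- The end of a lifted walk is determined by its start and by its image. -/
theorem eq_of_mapWalk_eq {F : W ⥤q V} (hF : F.IsCovering) {x y y₂ : W} {γ : WalkClass x y}
    {γ₂ : WalkClass x y₂}
    (h : (⟨F.obj y, mapWalk F γ⟩ : Σ t, WalkClass (F.obj x) t) = ⟨F.obj y₂, mapWalk F γ₂⟩) :
    y = y₂ := by
  have := congrArg (fun r : Σ t, WalkClass (F.obj x) t => (transport hF r.2 ⟨x, rfl⟩).1) h
  simpa [transport_mapWalk] using this

/-! ### Morphisms of coverings -/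

theorem prefunctor_ext_sigma {F G : W ⥤q V} (h_obj : ∀ x, F.obj x = G.obj x)
    (h : ∀ {x y : W} (a : x ⟶ y),
      (⟨F.obj x, F.obj y, F.map a⟩ : Σ x y : V, x ⟶ y) = ⟨G.obj x, G.obj y, G.map a⟩) :
    F = G := by
  obtain ⟨fo, fm⟩ := F
  obtain ⟨go, gm⟩ := G
  obtain rfl : fo = go := funext h_obj
  congr 1
  funext x y a
  have := h a
  simpa using this

theorem surjective_of_isCovering {F : W ⥤q V} (hF : F.IsCovering) (hW : Nonempty W)
    (hV : IsConnectedQuiver V) : Function.Surjective F.obj := by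
  intro y
  obtain ⟨x'⟩ := hW
  obtain ⟨γ⟩ := (isConnectedQuiver_iff.1 hV).2 (F.obj x') y
  obtain ⟨y', γ', h⟩ := exists_lift_walk hF x' γ
  exact ⟨y', congrArg Sigma.fst h⟩

theorem overArrow_map_comp {U : Type*} [Quiver U] {E : W ⥤q U} {F₁ : U ⥤q V} {x y : W}
    (a : x ⟶ y) : OverArrow F₁ ((E ⋙q F₁).map a) (E.obj x) (E.obj y) :=
  ⟨E.map a, rfl⟩

/-- Two morphisms into a covering that agree over the base and at one vertex are equal. -/
theorem eq_of_comp_eq_of_obj_eq {U : Type*} [Quiver U] {E E' : W ⥤q U} {F₁ : U ⥤q V}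
    (hF₁ : F₁.IsCovering) (hW : IsConnectedQuiver W) (h : E ⋙q F₁ = E' ⋙q F₁) {x₀ : W}
    (h₀ : E.obj x₀ = E'.obj x₀) : E = E' := by
  have hover : ∀ {x y : W} (a : x ⟶ y), OverArrow F₁ ((E ⋙q F₁).map a) (E'.obj x) (E'.obj y) := by
    intro x y a
    rw [h]
    exact overArrow_map_comp a
  -- Agreement spreads along a walk from `x₀`: the images of an arrow under `E` and `E'` lie over
  -- the same arrow and share one end, hence share the other.
  have hobj : ∀ y, E.obj y = E'.obj y := by
    intro y
    obtain ⟨γ⟩ := (isConnectedQuiver_iff.1 hW).2 x₀ y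
    induction γ using walkClass_induction with
    | nil => exact h₀
    | pos y t γ a ih =>
      have h1 := hover a
      rw [← ih] at h1
      exact congrArg Subtype.val ((existsUnique_overArrow_target hF₁ ((E ⋙q F₁).map a)
        ⟨E.obj y, rfl⟩).unique (y₁ := ⟨E.obj t, rfl⟩)
          (y₂ := ⟨E'.obj t, (Prefunctor.congr_obj h t).symm⟩) (overArrow_map_comp a) h1)
    | neg y t γ a ih =>
      have h1 := hover a
      rw [← ih] at h1
      exact congrArg Subtype.val ((existsUnique_overArrow_source hF₁ ((E ⋙q F₁).map a)
        ⟨E.obj y, rfl⟩).unique (y₁ := ⟨E.obj t, rfl⟩)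
          (y₂ := ⟨E'.obj t, (Prefunctor.congr_obj h t).symm⟩) (overArrow_map_comp a) h1)
  obtain ⟨fo, fm⟩ := E
  obtain ⟨go, gm⟩ := E'
  obtain rfl : fo = go := funext hobj
  congr 1
  funext x y a
  refine hF₁.map_injective _ ?_
  exact Prefunctor.congr_hom h a

/-- A morphism `F` lifts along a covering if the transport along the images of all closed walks
fixes the given vertex. -/
theorem exists_lift_of_transport_eq {U : Type*} [Quiver U] {F : W ⥤q V} {F₁ : U ⥤q V}
    (hF₁ : F₁.IsCovering) (hW : IsConnectedQuiver W) {x₀ : W} (u₀ : Fiber F₁ (F.obj x₀))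
    (h : ∀ γ : WalkClass x₀ x₀, transport hF₁ (mapWalk F γ) u₀ = u₀) :
    ∃ E : W ⥤q U, E ⋙q F₁ = F ∧ E.obj x₀ = u₀.1 := by
  -- The value of `E` at `y` is the point reached from `u₀` by transport along the image of a walk
  -- from `x₀` to `y`; the hypothesis on closed walks makes it independent of the walk (`he`).
  let γ : ∀ y : W, WalkClass x₀ y := fun y => ((isConnectedQuiver_iff.1 hW).2 x₀ y).some
  let e : ∀ y : W, Fiber F₁ (F.obj y) := fun y => transport hF₁ (mapWalk F (γ y)) u₀
  have he : ∀ {y : W} (η : WalkClass x₀ y), transport hF₁ (mapWalk F η) u₀ = e y := by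
    intro y η
    have := h (η ≫ Groupoid.inv (γ y))
    rwa [mapWalk_comp, mapWalk_inv, transport_comp, transport_inv, Equiv.symm_apply_eq] at this
  have ha : ∀ {y t : W} (a : y ⟶ t), OverArrow F₁ (F.map a) (e y).1 (e t).1 := by
    intro y t a
    have : e t = arrowTransport hF₁ (F.map a) (e y) := by
      rw [← he (γ y ≫ (FreeGroupoid.of W).map a)]
      simp [e]
    rw [this]
    exact overArrow_arrowTransport hF₁ _ _
  choose m hm using @ha
  refine ⟨⟨fun y => (e y).1, fun a => m a⟩, prefunctor_ext_sigma (fun y => (e y).2) fun a => hm a, ?_⟩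
  have := he (𝟙 ((FreeGroupoid.of W).obj x₀))
  rw [mapWalk_id, transport_id] at this
  exact congrArg Subtype.val this.symm

/-- A factor of a Galois covering is a Galois covering. -/
theorem IsGaloisCovering.of_comp {U : Type*} [Quiver U] {E : W ⥤q U} {F₁ : U ⥤q V}
    (h : IsGaloisCovering (E ⋙q F₁)) (hF₁ : F₁.IsCovering) (hU : IsConnectedQuiver U) :
    IsGaloisCovering E where
  connected_source := h.connected_source
  connected_target := hU
  surjective := surjective_of_isCovering (.of_comp_right _ _ hF₁ h.isCovering)
    h.connected_source.1 hU
  isCovering := .of_comp_right _ _ hF₁ h.isCovering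
  normal x := by
    have hE : E.IsCovering := .of_comp_right _ _ hF₁ h.isCovering
    -- Let `F₁(β)` be the image of a closed walk at `x`. The lift of `β` along `E` from `x` has the
    -- same image in the base as that closed walk, so it ends at `x` too. The range for `E` is thus
    -- a preimage of a normal subgroup.
    have key : ((freeGroupoidFunctor E).mapEnd ((FreeGroupoid.of W).obj x)).range =
        (((freeGroupoidFunctor (E ⋙q F₁)).mapEnd ((FreeGroupoid.of W).obj x)).range).comap
          ((freeGroupoidFunctor F₁).mapEnd ((FreeGroupoid.of U).obj (E.obj x))) := by
      ext β
      constructor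
      · rintro ⟨γ, rfl⟩
        exact ⟨γ, mapWalk_comp_apply E F₁ γ⟩
      · rintro ⟨γ, hγ⟩
        obtain ⟨y, γ', e⟩ := exists_lift_walk hE x β
        have e' := congrArg (fun r : Σ t, WalkClass (E.obj x) t =>
          (⟨F₁.obj r.1, mapWalk F₁ r.2⟩ : Σ t, WalkClass (F₁.obj (E.obj x)) t)) e
        have hγ' : mapWalk (E ⋙q F₁) γ = mapWalk F₁ β := hγ
        obtain rfl : y = x := by
          refine eq_of_mapWalk_eq h.isCovering (γ := γ') (γ₂ := γ) ?_
          rw [hγ', mapWalk_comp_apply]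
          exact e'
        exact ⟨γ', eq_of_heq (Sigma.mk.inj e).2⟩
    rw [key]
    have := h.normal x
    exact Subgroup.Normal.comap this _

end Monodromy

end PathCoalg

end

noncomputable section

namespace PathCoalg

/-! ### The smash coproduct of a homogeneous subcoalgebra as a covering. -/

section SmashLinear

variable {k : Type z} [Field k] {V : Type u} [Quiver.{v} V] {G : Type w} [Group G]
  (δ : ArrowWeighting V G)

/-! ### The smash coproduct as a covering -/

theorem smashProj_isCovering : (smashProj δ).IsCovering where
  star_bijective := smashProj_star_bijective δ
  costar_bijective X := by
    constructor
    · rintro ⟨⟨y, h⟩, a, ha⟩ ⟨⟨y', h'⟩, a', ha'⟩ e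
      obtain ⟨e1, e2⟩ := Sigma.mk.inj e
      change y = y' at e1
      subst e1
      obtain rfl : a = a' := eq_of_heq e2
      have hh : h = h' := mul_left_cancel (ha.symm.trans ha')
      subst hh
      rfl
    · rintro ⟨y, a⟩
      exact ⟨⟨⟨y, (δ a)⁻¹ * X.deg⟩, ⟨a, (mul_inv_cancel_left _ _).symm⟩⟩, rfl⟩

theorem smashProj_surjective : Function.Surjective (smashProj δ).obj := fun x => ⟨⟨x, 1⟩, rfl⟩

/-- The lifting with constant group component `g`. -/
def constLift (g : G) (x : V) : SmashQuiver δ := ⟨x, g⟩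

theorem smashProj_constLift (g : G) (x : V) : (smashProj δ).obj (constLift δ g x) = x := rfl

theorem smashIso_basis (P : AllPaths (SmashQuiver δ)) :
    smashIso k δ (pathBasis k _ P) = smashBasis k δ (mapAll (smashProj δ) P, P.1.deg) :=
  (pathBasis k _).constr_basis k _ _

theorem smashElem_basis {G : Type w} (δ : ArrowWeighting V G) (g : G) (P : AllPaths V) :
    smashElem δ g (pathBasis k V P) = smashPath k δ P.2.2 g :=
  (pathBasis k V).constr_basis k _ _

/-- Under the identification of `k(Q ⋊ G)` with `k Q ⋊ k G`, the lifting of `b` with constant group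
component `g` is `b ⋊ g`. -/
theorem smashIso_liftElem (g : G) (b : PathCoalgebra k V) :
    smashIso k δ (liftElem (smashProj_isCovering δ) (smashProj_constLift δ g) b) =
      smashElem δ g b := by
  refine LinearMap.congr_fun (f := (smashIso k δ).toLinearEquiv.toLinearMap ∘ₗ
    liftElem (smashProj_isCovering δ) (smashProj_constLift δ g))
    (g := smashElem δ g) ?_ b
  refine (pathBasis k V).ext fun P => ?_
  change smashIso k δ (liftElem _ _ (pathBasis k V P)) = _
  rw [liftElem_basis, smashIso_basis, mapAll_liftPath, liftPath_fst]
  exact (smashElem_basis δ g P).symm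

theorem liftElem_mem_smashCover (g : G) {B : Submodule k (PathCoalgebra k V)}
    {b : PathCoalgebra k V} (hb : b ∈ B) :
    liftElem (smashProj_isCovering δ) (smashProj_constLift δ g) b ∈
      smashCover δ B := by
  change smashIso k δ _ ∈ smashSub δ B
  rw [smashIso_liftElem]
  exact Submodule.mem_iSup_of_mem g ⟨b, hb, rfl⟩

/-- Liftings with constant group component suffice: an element starting at `x ⋊ g` is the lifting of
its image with constant component `g`, and such liftings are the elements `b ⋊ g`. -/
theorem smashCover_eq_liftSpan {B : Submodule k (PathCoalgebra k V)} (hB : IsSumOfHomParts B) :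
    smashCover δ B = liftSpan (smashProj_isCovering δ) B := by
  apply le_antisymm
  · have h : smashSub δ B ≤ (liftSpan (smashProj_isCovering δ) B).map
        (smashIso k δ).toLinearEquiv.toLinearMap := by
      refine iSup_le fun g => ?_
      rintro _ ⟨b, hb, rfl⟩
      rw [← smashIso_liftElem]
      exact ⟨_, liftElem_mem_liftSpan _ hB _ hb, rfl⟩
    intro c hc
    obtain ⟨d, hd, e⟩ := h hc
    rwa [← (smashIso k δ).toLinearEquiv.injective e]
  · rw [liftSpan_eq_span _ (smashProj_surjective δ) hB]
    refine Submodule.span_le.2 ?_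
    rintro c ⟨⟨⟨x, g⟩, hc⟩, h⟩
    rw [← hc.liftElem_pathMap (smashProj_isCovering δ) (smashProj_constLift δ g) rfl]
    exact liftElem_mem_smashCover δ g h

/-! ### Homogeneous subspaces and subcoalgebras -/

/-- All paths that occur in `b` have weight `g`. -/
def HasWeight (g : G) (b : PathCoalgebra k V) : Prop :=
  ∀ P ∈ supp b, pathWeight δ P.2.2 = g

variable {δ}

/-- Projection to one weight fixes or kills each homogeneous generator, so it preserves their span
`B`. -/
theorem isHomogeneousSub_of_minimal {B : Submodule k (PathCoalgebra k V)}
    (hB : IsSumOfHomParts B) (h : ∀ x y b, IsMinimal B x y b → ∃ g, HasWeight δ g b) :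
    IsHomogeneousSub δ B := by
  intro b hb g
  have key : Submodule.span k (minimalOrPath B) ≤
      B.comap (partialSumHom {p : AllPaths V | pathWeight δ p.2.2 = g}) := by
    refine Submodule.span_le.2 fun b hb => ?_
    change partialSum _ b ∈ B
    have hw : ∃ g', HasWeight δ g' b := by
      rcases hb with ⟨x, y, hb⟩ | ⟨-, x, y, p, rfl⟩
      · exact h x y b hb
      · refine ⟨pathWeight δ p, fun P hP => ?_⟩
        rw [supp_ofPath, Finset.mem_singleton] at hP
        rw [hP]
    obtain ⟨g', hg'⟩ := hw
    by_cases e : g' = g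
    · have : partialSum {p : AllPaths V | pathWeight δ p.2.2 = g} b = b :=
        partialSum_eq_self fun P hP => (hg' P hP).trans e
      rw [this]
      exact minimalOrPath_subset B hb
    · have : partialSum {p : AllPaths V | pathWeight δ p.2.2 = g} b = 0 :=
        partialSum_eq_zero fun P hP hP' => e ((hg' P hP).symm.trans hP')
      rw [this]
      exact B.zero_mem
  exact key (hB.span_minimalOrPath.symm ▸ hb)

theorem IsHomogeneousSub.induction {B : Submodule k (PathCoalgebra k V)}
    (hB : IsHomogeneousSub δ B) (M : Submodule k (PathCoalgebra k V))
    (h : ∀ b ∈ B, ∀ g, HasWeight δ g b → b ∈ M) : B ≤ M := by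
  classical
  intro b hb
  rw [← sum_partialSum_fiber (fun P => pathWeight δ P.2.2) b
    ((supp b).image fun P => pathWeight δ P.2.2) fun P hP => Finset.mem_image_of_mem _ hP]
  exact Submodule.sum_mem _ fun g _ =>
    h _ (hB b hb g) g fun P hP => (mem_supp_partialSum.1 hP).2

variable (δ)

/-- The linear map `q ⊗ r ↦ (q ⋊ δ(r) g) ⊗ (r ⋊ g)`. -/
def smashTwist (g : G) : PathCoalgebra k V ⊗[k] PathCoalgebra k V →ₗ[k]
    SmashCoproduct k δ ⊗[k] SmashCoproduct k δ :=
  TensorProduct.lift (((pathBasis k V).constr k fun P =>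
    (TensorProduct.mk k _ _).flip (smashPath k δ P.2.2 g) ∘ₗ
      smashElem δ (pathWeight δ P.2.2 * g)).flip)

theorem smashTwist_tmul_basis (g : G) (b : PathCoalgebra k V) (P : AllPaths V) :
    smashTwist δ g (b ⊗ₜ pathBasis k V P) =
      smashElem δ (pathWeight δ P.2.2 * g) b ⊗ₜ smashPath k δ P.2.2 g := by
  rw [smashTwist, TensorProduct.lift.tmul, LinearMap.flip_apply, Module.Basis.constr_basis]
  rfl

theorem smashTwist_comul (g : G) (b : PathCoalgebra k V) :
    Coalgebra.comul (R := k) (smashElem δ g b) = smashTwist δ g (Coalgebra.comul (R := k) b) := by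
  refine LinearMap.congr_fun (f := Coalgebra.comul ∘ₗ smashElem δ g)
    (g := smashTwist δ g ∘ₗ Coalgebra.comul) ?_ b
  refine (pathBasis k V).ext ?_
  rintro ⟨x, y, p⟩
  change Coalgebra.comul (smashElem δ g (pathBasis k V (toAll p))) =
    smashTwist δ g (Coalgebra.comul (ofPath k p))
  rw [smashElem_basis, comul_smashPath, comul_ofPath, map_list_sum, List.map_map]
  refine congrArg List.sum (List.map_congr_left fun d _ => ?_)
  exact ((smashTwist_tmul_basis δ g (ofPath k d.2.2) (toAll d.2.1)).trans
    (congrArg (· ⊗ₜ[k] _) (smashElem_basis δ _ (toAll d.2.2)))).symm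

theorem smashTwist_tmul (g h : G) (b c : PathCoalgebra k V) (hc : HasWeight δ h c) :
    smashTwist δ g (b ⊗ₜ c) = smashElem δ (h * g) b ⊗ₜ smashElem δ g c := by
  rw [← (pathBasis k V).linearCombination_repr c, Finsupp.linearCombination_apply, Finsupp.sum,
    TensorProduct.tmul_sum, map_sum, map_sum, TensorProduct.tmul_sum]
  refine Finset.sum_congr rfl fun P hP => ?_
  rw [TensorProduct.tmul_smul, map_smul, map_smul, TensorProduct.tmul_smul, smashTwist_tmul_basis,
    smashElem_basis, hc P hP]

/-- `Δ(b ⋊ g)` is the twist of `Δ(b)`. The twist shifts the left factor by the weight of the right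
one, so it yields a pure tensor of elements of `B ⋊ k G` when the right factor is homogeneous;
homogeneity of `B` reduces the general case to this one. -/
theorem smashSub_isSubcoalgebra {B : Submodule k (PathCoalgebra k V)} (hB : IsSubcoalgebra B)
    (hδ : IsHomogeneousSub δ B) : IsSubcoalgebra (smashSub δ B) := by
  set R := LinearMap.range (TensorProduct.map (smashSub δ B).subtype (smashSub δ B).subtype)
    with hR
  have hmem : ∀ (g : G), ∀ b ∈ B, smashElem δ g b ∈ smashSub δ B := fun g b hb =>
    Submodule.mem_iSup_of_mem g ⟨b, hb, rfl⟩
  have htw : ∀ (g : G) (b : B), ∀ c ∈ B, smashTwist δ g ((b : PathCoalgebra k V) ⊗ₜ c) ∈ R := by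
    intro g b
    refine hδ.induction (R.comap (smashTwist δ g ∘ₗ TensorProduct.mk k _ _ b.1)) ?_
    intro c hc h hw
    change smashTwist δ g ((b : PathCoalgebra k V) ⊗ₜ c) ∈ R
    rw [smashTwist_tmul δ g h _ _ hw]
    exact ⟨⟨_, hmem _ _ b.2⟩ ⊗ₜ ⟨_, hmem _ _ hc⟩, rfl⟩
  have key : smashSub δ B ≤ R.comap Coalgebra.comul := by
    refine iSup_le fun g => ?_
    rintro _ ⟨b, hb, rfl⟩
    change Coalgebra.comul (smashElem δ g b) ∈ R
    rw [smashTwist_comul]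
    obtain ⟨t, ht⟩ := hB b hb
    rw [← ht]
    clear ht
    induction t using TensorProduct.induction_on with
    | zero => simp
    | tmul b c => exact htw g b c c.2
    | add t t' h h' =>
      rw [map_add, map_add]
      exact R.add_mem h h'
  exact fun c hc => key hc

theorem IsSubcoalgebra.comap_coalgEquiv {C D : Type*} [AddCommGroup C] [Module k C]
    [Coalgebra k C] [AddCommGroup D] [Module k D] [Coalgebra k D] (e : C ≃ₗc[k] D)
    {B : Submodule k D} (hB : IsSubcoalgebra B) :
    IsSubcoalgebra (B.comap e.toLinearEquiv.toLinearMap) := by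
  intro c hc
  have hinj : Function.Injective
      (TensorProduct.map e.toLinearEquiv.toLinearMap e.toLinearEquiv.toLinearMap) :=
    (TensorProduct.congr e.toLinearEquiv e.toLinearEquiv).injective
  obtain ⟨t, ht⟩ := hB (e c) hc
  have he : Coalgebra.comul (R := k) (e c) =
      TensorProduct.map e.toLinearEquiv.toLinearMap e.toLinearEquiv.toLinearMap
        (Coalgebra.comul (R := k) c) :=
    (LinearMap.congr_fun e.toCoalgHom.map_comp_comul c).symm
  have hsub : ∀ t : B ⊗[k] B, ∃ s : (B.comap e.toLinearEquiv.toLinearMap) ⊗[k]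
      (B.comap e.toLinearEquiv.toLinearMap),
      TensorProduct.map e.toLinearEquiv.toLinearMap e.toLinearEquiv.toLinearMap
        (TensorProduct.map (Submodule.subtype _) (Submodule.subtype _) s) =
      TensorProduct.map B.subtype B.subtype t := by
    intro t
    induction t using TensorProduct.induction_on with
    | zero => exact ⟨0, by rw [map_zero, map_zero, map_zero]⟩
    | tmul b b' =>
      refine ⟨⟨e.toLinearEquiv.symm b, ?_⟩ ⊗ₜ ⟨e.toLinearEquiv.symm b', ?_⟩, ?_⟩
      · change e.toLinearEquiv (e.toLinearEquiv.symm b) ∈ B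
        rw [LinearEquiv.apply_symm_apply]
        exact b.2
      · change e.toLinearEquiv (e.toLinearEquiv.symm b') ∈ B
        rw [LinearEquiv.apply_symm_apply]
        exact b'.2
      · change e.toLinearEquiv (e.toLinearEquiv.symm b) ⊗ₜ[k]
          e.toLinearEquiv (e.toLinearEquiv.symm b') = _
        rw [LinearEquiv.apply_symm_apply, LinearEquiv.apply_symm_apply]
        rfl
    | add t t' h h' =>
      obtain ⟨s, hs⟩ := h
      obtain ⟨s', hs'⟩ := h'
      exact ⟨s + s', by rw [map_add, map_add, map_add, hs, hs']⟩
  obtain ⟨s, hs⟩ := hsub t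
  exact ⟨s, hinj (hs.trans (ht.trans he))⟩

theorem smashCover_isAdmissible {B : Submodule k (PathCoalgebra k V)} (hB : IsAdmissible B)
    (hδ : IsHomogeneousSub δ B) : IsAdmissible (smashCover δ B) := by
  have hmem : ∀ {X Y : SmashQuiver δ} (p : Path X Y), ofPath k ((smashProj δ).mapPath p) ∈ B →
      ofPath k p ∈ smashCover δ B := by
    intro X Y p hp
    change smashIso k δ (pathBasis k _ (toAll p)) ∈ smashSub δ B
    rw [smashIso_basis]
    exact Submodule.mem_iSup_of_mem X.deg ⟨_, hp, smashElem_basis δ _ _⟩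
  exact ⟨(smashSub_isSubcoalgebra δ hB.isSubcoalgebra hδ).comap_coalgEquiv (smashIso k δ),
    fun X => hmem _ (hB.vertex_mem X.vertex), fun a => hmem _ (hB.arrow_mem a.1)⟩

/-- If every minimal element of `B` is homogeneous, then minimal elements lift to the smash
coproduct. -/
theorem smashCover_lift_minimal {B : Submodule k (PathCoalgebra k V)} (hB : IsSumOfHomParts B)
    (h : ∀ x y b, IsMinimal B x y b → ∃ g, HasWeight δ g b) (x y : V) (b : PathCoalgebra k V)
    (hb : IsMinimal B x y b) (X : SmashQuiver δ) (hX : (smashProj δ).obj X = x) :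
    ∃ (Y : SmashQuiver δ) (c : PathCoalgebra k (SmashQuiver δ)),
      IsMinimal (smashCover δ B) X Y c ∧ pathMap k (smashProj δ) c = b := by
  subst hX
  obtain ⟨g, hg⟩ := h _ _ b hb
  have hF := smashProj_isCovering δ
  set c := liftElem hF (smashProj_constLift δ X.deg) b with hc
  have hcb : pathMap k (smashProj δ) c = b := pathMap_liftElem _ _ _
  have hst : StartsAt X c := hb.startsAt.liftElem hF (smashProj_constLift δ X.deg)
  -- All paths of `b` have weight `g`, so all their lifts from `X` end at this vertex.
  refine ⟨⟨y, g * X.deg⟩, c, ?_, hcb⟩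
  refine IsMinimal.of_pathMap hF (F := smashProj δ) (B := B) ?_ ?_ ?_
  · intro d hd
    rw [smashCover_eq_liftSpan δ hB] at hd
    exact pathMap_mem_of_mem_liftSpan hF hd
  · refine mem_homPart_iff.2 ⟨liftElem_mem_smashCover δ X.deg (mem_homPart_iff.1 hb.mem).1,
      fun P hP => ⟨hst P hP, ?_⟩⟩
    have hP' : mapAll (smashProj δ) P ∈ supp b := by
      classical
      rw [← hcb, hst.supp_pathMap hF]
      exact Finset.mem_image_of_mem _ hP
    refine SmashQuiver.ext ((mem_homPart_iff.1 hb.mem).2 _ hP').2 ?_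
    have h1 := smashQuiver_deg δ P.2.2
    have h2 : pathWeight δ ((smashProj δ).mapPath P.2.2) = g := hg _ hP'
    rw [← h1, h2, hst P hP]
  · rw [hcb]
    exact hb

end SmashLinear

end PathCoalg

end

noncomputable section

namespace PathCoalg

/-! ### Weights of walks, the Galois property of `Q ⋊ G`, and its lifts to other coverings. -/

section UniversalCover

variable {k : Type z} [Field k] {V : Type u} [Quiver.{v} V]
  (B : Submodule k (PathCoalgebra k V)) (x₀ : V) (c : ∀ x : V, WalkClass x₀ x)

/-! ### The weight of a walk -/

/-- The extension of the universal weighting to walk classes. -/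
def walkWeight {x y : V} (γ : WalkClass x y) : Pi1 V x₀ ⧸ relSubgroup B x₀ :=
  QuotientGroup.mk (End.of (c x ≫ γ ≫ Groupoid.inv (c y)))

theorem walkWeight_of {x y : V} (a : x ⟶ y) :
    walkWeight B x₀ c ((FreeGroupoid.of V).map a) = universalWeighting B x₀ c a := rfl

/-- The inserted return along `c y` cancels. The factors change order because products in `End` run
the right factor first. -/
theorem walkWeight_comp {x y t : V} (γ : WalkClass x y) (η : WalkClass y t) :
    walkWeight B x₀ c (γ ≫ η) = walkWeight B x₀ c η * walkWeight B x₀ c γ := by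
  have h : c x ≫ (γ ≫ η) ≫ Groupoid.inv (c t) =
      (c x ≫ γ ≫ Groupoid.inv (c y)) ≫ (c y ≫ η ≫ Groupoid.inv (c t)) := by
    simp
  rw [walkWeight, h]
  rfl

theorem walkWeight_id (x : V) : walkWeight B x₀ c (𝟙 ((FreeGroupoid.of V).obj x)) = 1 := by
  have h : c x ≫ 𝟙 _ ≫ Groupoid.inv (c x) = 𝟙 _ := by simp
  rw [walkWeight, h]
  rfl

theorem walkWeight_inv {x y : V} (γ : WalkClass x y) :
    walkWeight B x₀ c (Groupoid.inv γ) = (walkWeight B x₀ c γ)⁻¹ := by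
  refine eq_inv_of_mul_eq_one_left ?_
  rw [← walkWeight_comp, Groupoid.comp_inv, walkWeight_id]

theorem walkWeight_conj_eq_one {x y : V} (γ : WalkClass x y) {β : WalkClass x x}
    (hβ : walkWeight B x₀ c β = 1) : walkWeight B x₀ c (Groupoid.inv γ ≫ β ≫ γ) = 1 := by
  rw [walkWeight_comp, walkWeight_comp, hβ, walkWeight_inv, mul_one, mul_inv_cancel]

theorem pathWeight_universalWeighting {x y : V} (p : Path x y) :
    pathWeight (universalWeighting B x₀ c) p = walkWeight B x₀ c (pathClass p) := by
  induction p with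
  | nil => exact (walkWeight_id B x₀ c x).symm
  | cons p a ih => rw [pathWeight, ih, pathClass_cons, walkWeight_comp, walkWeight_of]

variable {B}

/-- The loop "`q`, then `p` backwards", based at `x₀` by means of `w = c x`, is one of the
generators of `N(B, x₀)`. -/
theorem PathRel.pathWeight_eq {x y : V} {p q : Path x y} (h : PathRel B p q) :
    pathWeight (universalWeighting B x₀ c) p = pathWeight (universalWeighting B x₀ c) q := by
  have h1 : walkWeight B x₀ c (pathClass q ≫ Groupoid.inv (pathClass p)) = 1 := by
    refine (QuotientGroup.eq_one_iff _).2 (Subgroup.subset_normalClosure ?_)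
    exact ⟨x, y, p, q, c x, h, by rw [Category.assoc]⟩
  rw [walkWeight_comp, walkWeight_inv, inv_mul_eq_one] at h1
  rw [pathWeight_universalWeighting, pathWeight_universalWeighting, h1]

theorem IsMinimal.exists_hasWeight {x y : V} {b : PathCoalgebra k V} (hb : IsMinimal B x y b) :
    ∃ g, HasWeight (universalWeighting B x₀ c) g b := by
  have hpos : 0 < (supp b).card := lt_of_lt_of_le Nat.two_pos hb.two_le
  obtain ⟨⟨x', y', p⟩, hp⟩ := Finset.card_pos.1 hpos
  obtain ⟨rfl, rfl⟩ := (mem_homPart_iff.1 hb.mem).2 _ hp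
  refine ⟨pathWeight (universalWeighting B x₀ c) p, ?_⟩
  rintro ⟨x₂, y₂, q⟩ hq
  obtain ⟨e1, e2⟩ := (mem_homPart_iff.1 hb.mem).2 _ hq
  dsimp only at e1 e2
  subst e1 e2
  by_cases hpq : q = p
  · rw [hpq]
  · exact PathRel.pathWeight_eq x₀ c ⟨hpq, b, hb, hq, hp⟩

variable (B)

/-- The group component records the accumulated weight, since an arrow multiplies it by its weight
on the left. The end of a lifted walk can therefore be read off from its weight. -/
theorem deg_eq_walkWeight_mul {X Y : UniversalQuiver B x₀ c} (γ : WalkClass X Y) :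
    Y.deg = walkWeight B x₀ c (mapWalk (universalProj B x₀ c) γ) * X.deg := by
  induction γ using walkClass_induction with
  | nil =>
    rw [mapWalk_id, walkWeight_id, one_mul]
  | pos Y T γ a ih =>
    rw [mapWalk_comp, walkWeight_comp, mul_assoc, ← ih]
    exact a.2
  | neg Y T γ a ih =>
    rw [mapWalk_comp, walkWeight_comp, mul_assoc, ← ih, mapWalk_inv, walkWeight_inv,
      eq_inv_mul_iff_mul_eq]
    exact a.2.symm

theorem exists_lift_walk_universal {X Y : UniversalQuiver B x₀ c}
    (γ : WalkClass X.vertex Y.vertex) (h : Y.deg = walkWeight B x₀ c γ * X.deg) :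
    ∃ γ' : WalkClass X Y, mapWalk (universalProj B x₀ c) γ' = γ := by
  obtain ⟨Y', γ', e⟩ := exists_lift_walk (smashProj_isCovering (universalWeighting B x₀ c)) X γ
  have hw := congrArg (fun r : Σ t, WalkClass X.vertex t => walkWeight B x₀ c r.2) e
  obtain rfl : Y' = Y := by
    refine SmashQuiver.ext (congrArg Sigma.fst e) ?_
    rw [deg_eq_walkWeight_mul B x₀ c γ', h]
    exact congrArg (· * X.deg) hw
  exact ⟨γ', eq_of_heq (Sigma.mk.inj e).2⟩

theorem universalQuiver_isConnected : IsConnectedQuiver (UniversalQuiver B x₀ c) := by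
  refine isConnectedQuiver_iff.2 ⟨⟨⟨x₀, 1⟩⟩, fun X Y => ?_⟩
  obtain ⟨g, hg⟩ := QuotientGroup.mk_surjective (Y.deg * X.deg⁻¹)
  -- Back to `x₀`, around the loop `g`, then out to `Y.vertex`: every element of the quotient is the
  -- weight of such a walk.
  have hγ : walkWeight B x₀ c (Groupoid.inv (c X.vertex) ≫ (g : WalkClass x₀ x₀) ≫ c Y.vertex) =
      Y.deg * X.deg⁻¹ := by
    have h : c X.vertex ≫ (Groupoid.inv (c X.vertex) ≫ (g : WalkClass x₀ x₀) ≫ c Y.vertex) ≫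
        Groupoid.inv (c Y.vertex) = g := by
      simp
    rw [walkWeight, h]
    exact hg
  obtain ⟨γ, -⟩ := exists_lift_walk_universal B x₀ c (X := X) (Y := Y) _
    (by rw [hγ, inv_mul_cancel_right])
  exact ⟨γ⟩

/-- The closed walks that lift to closed walks are those that leave the group component unchanged.
They form the kernel of the weight, whence the normality required of a Galois covering. -/
theorem mem_range_mapEnd_universal_iff (X : UniversalQuiver B x₀ c) (β : Pi1 V X.vertex) :
    β ∈ ((freeGroupoidFunctor (universalProj B x₀ c)).mapEnd
      ((FreeGroupoid.of (UniversalQuiver B x₀ c)).obj X)).range ↔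
      walkWeight B x₀ c (β : WalkClass X.vertex X.vertex) = 1 := by
  constructor
  · rintro ⟨γ, rfl⟩
    exact mul_eq_right.1 (deg_eq_walkWeight_mul B x₀ c γ).symm
  · intro h
    exact exists_lift_walk_universal B x₀ c (X := X) (Y := X) β (by rw [h, one_mul])

theorem universalProj_isGaloisCovering (hV : IsConnectedQuiver V) :
    IsGaloisCovering (universalProj B x₀ c) where
  connected_source := universalQuiver_isConnected B x₀ c
  connected_target := hV
  surjective := smashProj_surjective _
  isCovering := smashProj_isCovering _
  normal X := by
    constructor
    intro β hβ g
    have h1 := (mem_range_mapEnd_universal_iff B x₀ c X β).1 hβ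
    refine (mem_range_mapEnd_universal_iff B x₀ c X _).2 ?_
    exact walkWeight_conj_eq_one B x₀ c g h1

variable {B}

theorem universalProj_isGaloisCoalgebraCovering (hV : IsConnectedQuiver V) (hB : IsAdmissible B) :
    IsGaloisCoalgebraCovering (universalProj B x₀ c) (universalCover B x₀ c) B where
  toIsGaloisCovering := universalProj_isGaloisCovering B x₀ c hV
  eq_liftSpan := smashCover_eq_liftSpan _ hB.isSubcoalgebra.isSumOfHomParts
  lift_minimal := smashCover_lift_minimal _ hB.isSubcoalgebra.isSumOfHomParts
    fun _ _ _ hb => hb.exists_hasWeight x₀ c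

/-! ### Lifting the universal covering along other coverings -/

variable {U : Type w} [Quiver.{w'} U] {F₁ : U ⥤q V} {B₁ : Submodule k (PathCoalgebra k U)}

/-- The minimal element containing `p` and `q` lifts, from the given point of the fibre, to a
minimal element with a single end vertex. The lifts of `p` and `q` both occur in it, so they end
together. -/
theorem PathRel.transport_eq (h₁ : IsGaloisCoalgebraCovering F₁ B₁ B) {x y : V} {p q : Path x y}
    (h : PathRel B p q) (u : Fiber F₁ x) :
    transport h₁.isCovering (pathClass p) u = transport h₁.isCovering (pathClass q) u := by
  obtain ⟨-, b, hb, hp, hq⟩ := h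
  obtain ⟨x', rfl⟩ := u
  obtain ⟨y', b', hb', rfl⟩ := h₁.lift_minimal _ _ _ hb x' rfl
  have key : ∀ {r : Path (F₁.obj x') y}, toAll r ∈ supp (pathMap k F₁ b') →
      (transport h₁.isCovering (pathClass r) ⟨x', rfl⟩).1 = y' := by
    intro r hr
    obtain ⟨⟨s, t, R⟩, hR, e⟩ := exists_of_mem_supp_pathMap hr
    obtain ⟨rfl, rfl⟩ := (mem_homPart_iff.1 hb'.mem).2 _ hR
    have e' := eq_of_heq (Sigma.mk.inj e).2
    have := congrArg (fun r : Σ t, Path (F₁.obj s) t =>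
      (transport h₁.isCovering (pathClass r.2) ⟨s, rfl⟩).1) e'
    refine this.symm.trans ?_
    exact congrArg Subtype.val (transport_pathClass_mapPath h₁.isCovering R)
  exact Subtype.ext ((key hp).trans (key hq).symm)

/-- The group `N(B, x₀)` acts trivially on the fibres of Galois coalgebra coverings. -/
theorem transport_eq_of_mem_relSubgroup (h₁ : IsGaloisCoalgebraCovering F₁ B₁ B) {g : Pi1 V x₀}
    (hg : g ∈ relSubgroup B x₀) (u : Fiber F₁ x₀) :
    transport h₁.isCovering (g : WalkClass x₀ x₀) u = u := by
  let φ : Pi1 V x₀ →* Equiv.Perm (Fiber F₁ x₀) :=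
    { toFun := fun g => transport h₁.isCovering (g : WalkClass x₀ x₀)
      map_one' := Equiv.ext fun u => transport_id h₁.isCovering x₀ u
      map_mul' := fun g h => Equiv.ext fun u => transport_comp h₁.isCovering
        (h : WalkClass x₀ x₀) (g : WalkClass x₀ x₀) u }
  have hN : relSubgroup B x₀ ≤ φ.ker := by
    refine Subgroup.normalClosure_le_normal ?_
    rintro _ ⟨x, y, p, q, w, hpq, rfl⟩
    refine Equiv.ext fun u => ?_
    change transport h₁.isCovering
      (w ≫ pathClass q ≫ Groupoid.inv (pathClass p) ≫ Groupoid.inv w) u = u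
    rw [transport_comp, transport_comp, transport_comp, transport_inv, transport_inv,
      ← hpq.transport_eq h₁, Equiv.symm_apply_apply, Equiv.symm_apply_apply]
  exact Equiv.congr_fun (hN hg) u

/-- Conjugation by `c x` carries the walk to an element of `N(B, x₀)`, which acts trivially on the
fibre over `x₀`. -/
theorem transport_eq_of_walkWeight_eq_one (h₁ : IsGaloisCoalgebraCovering F₁ B₁ B) {x : V}
    {β : WalkClass x x} (hβ : walkWeight B x₀ c β = 1) (u : Fiber F₁ x) :
    transport h₁.isCovering β u = u := by
  have h := transport_eq_of_mem_relSubgroup x₀ h₁ ((QuotientGroup.eq_one_iff _).1 hβ)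
    ((transport h₁.isCovering (c x)).symm u)
  change transport h₁.isCovering (c x ≫ β ≫ Groupoid.inv (c x)) _ = _ at h
  rw [transport_comp, transport_comp, Equiv.apply_symm_apply, transport_inv] at h
  exact (Equiv.injective _) h

/-- The obstruction to lifting is the action of images of closed walks of `Q ⋊ G`. These have weight
`1` and so act trivially. -/
theorem exists_universalQuiver_lift (h₁ : IsGaloisCoalgebraCovering F₁ B₁ B)
    (X : UniversalQuiver B x₀ c) (u : U) (hu : (universalProj B x₀ c).obj X = F₁.obj u) :
    ∃ E : UniversalQuiver B x₀ c ⥤q U, E ⋙q F₁ = universalProj B x₀ c ∧ E.obj X = u := by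
  refine exists_lift_of_transport_eq h₁.isCovering (universalQuiver_isConnected B x₀ c)
    (u₀ := ⟨u, hu.symm⟩) fun γ => ?_
  exact transport_eq_of_walkWeight_eq_one x₀ c h₁
    ((mem_range_mapEnd_universal_iff B x₀ c X _).1 ⟨γ, rfl⟩) _

theorem isGaloisCoalgebraCovering_of_comp_eq_universalProj (hV : IsConnectedQuiver V)
    (hB : IsAdmissible B) (h₁ : IsGaloisCoalgebraCovering F₁ B₁ B)
    {E : UniversalQuiver B x₀ c ⥤q U} (hE : E ⋙q F₁ = universalProj B x₀ c) :
    IsGaloisCoalgebraCovering E (universalCover B x₀ c) B₁ := by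
  have h := universalProj_isGaloisCoalgebraCovering x₀ c hV hB
  rw [← hE] at h
  exact h.of_comp hB.isSubcoalgebra.isSumOfHomParts h₁
    (h.toIsGaloisCovering.of_comp h₁.isCovering h₁.connected_source)

end UniversalCover

end PathCoalg

end

/-! ### The universal property and its uniqueness. -/

theorem mainTheorem3 {k : Type z} [Field k] {V : Type u} [Quiver.{v} V]
    (hV : IsConnectedQuiver V)
    (B : Submodule k (PathCoalgebra k V)) (hB : IsAdmissible B)
    (x₀ : V) (c : ∀ x : V, WalkClass x₀ x) :
    -- the smash coproduct exists: `B` is graded, and `B ⋊ (π₁ / N)` is an admissible subcoalgebra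
    IsHomogeneousSub (universalWeighting B x₀ c) B ∧
    IsAdmissible (universalCover B x₀ c) ∧
    -- (a) it is a Galois coalgebra covering that factors all others
    IsUniversalCovering.{w, w'} (universalProj B x₀ c) (universalCover B x₀ c) B ∧
    -- (b) the factorization is unique once base points are fixed
    (∀ (U : Type w) [Quiver.{w'} U] (F₁ : U ⥤q V) (B₁ : Submodule k (PathCoalgebra k U)),
      IsGaloisCoalgebraCovering F₁ B₁ B →
      ∀ (x' : UniversalQuiver B x₀ c) (x₁ : U), (universalProj B x₀ c).obj x' = F₁.obj x₁ →
        ∃! E : UniversalQuiver B x₀ c ⥤q U,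
          IsGaloisCoalgebraCovering E (universalCover B x₀ c) B₁ ∧
            E ⋙q F₁ = universalProj B x₀ c ∧ E.obj x' = x₁) ∧
    -- (c) every covering with property (a) is isomorphic to it
    (∀ (U : Type w) [Quiver.{w'} U] (F₁ : U ⥤q V) (B₁ : Submodule k (PathCoalgebra k U)),
      IsUniversalCovering.{max u v, v} F₁ B₁ B →
        CoveringsIsomorphic (universalProj B x₀ c) (universalCover B x₀ c) F₁ B₁) := by
  have hcov := universalProj_isGaloisCoalgebraCovering x₀ c hV hB
  have hhom : IsHomogeneousSub (universalWeighting B x₀ c) B :=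
    isHomogeneousSub_of_minimal hB.isSubcoalgebra.isSumOfHomParts
      fun _ _ _ hb => hb.exists_hasWeight x₀ c
  refine ⟨hhom, smashCover_isAdmissible _ hB hhom, ⟨hcov, ?_⟩, ?_, ?_⟩
  · intro U _ F₁ B₁ h₁
    obtain ⟨u⟩ := h₁.connected_source.1
    obtain ⟨E, hE, -⟩ := exists_universalQuiver_lift x₀ c h₁ ⟨F₁.obj u, 1⟩ u rfl
    exact ⟨E, isGaloisCoalgebraCovering_of_comp_eq_universalProj x₀ c hV hB h₁ hE, hE⟩
  · intro U _ F₁ B₁ h₁ x' x₁ hx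
    obtain ⟨E, hE, hEx⟩ := exists_universalQuiver_lift x₀ c h₁ x' x₁ hx
    refine ⟨E, ⟨isGaloisCoalgebraCovering_of_comp_eq_universalProj x₀ c hV hB h₁ hE, hE, hEx⟩, ?_⟩
    rintro E' ⟨-, hE', hEx'⟩
    exact eq_of_comp_eq_of_obj_eq h₁.isCovering hcov.connected_source (hE'.trans hE.symm)
      (hEx'.trans hEx.symm)
  · rintro U _ F₁ B₁ ⟨h₁, huniv⟩
    obtain ⟨η, hη, hηF⟩ := huniv _ _ _ hcov
    obtain ⟨u⟩ := h₁.connected_source.1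
    -- The universal property of `F₁` supplies `η` only up to the choice of a vertex. Choosing `θ`
    -- with `η(u) ↦ u` makes both composites fix a vertex, so uniqueness of lifts turns them into
    -- identities.
    obtain ⟨θ, hθF, hθ⟩ := exists_universalQuiver_lift x₀ c h₁ (η.obj u) u
      (Prefunctor.congr_obj hηF u)
    have hθc := isGaloisCoalgebraCovering_of_comp_eq_universalProj x₀ c hV hB h₁ hθF
    refine ⟨θ, η, ⟨hθF, fun _ => hθc.pathMap_mem⟩, ⟨hηF, fun _ => hη.pathMap_mem⟩, ?_, ?_⟩
    · refine eq_of_comp_eq_of_obj_eq hcov.isCovering hcov.connected_source (x₀ := η.obj u) ?_ ?_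
      · rw [Prefunctor.comp_assoc, hηF, hθF, Prefunctor.id_comp]
      · exact congrArg η.obj hθ
    · refine eq_of_comp_eq_of_obj_eq h₁.isCovering h₁.connected_source (x₀ := u) ?_ hθ
      rw [Prefunctor.comp_assoc, hθF, hηF, Prefunctor.id_comp]
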